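/- Let $\mathsf k$ be a complex Hilbert space. For an interval $A\subseteq\mathbb R_+$ let $\mathcal F_A$ be the Boson Fock space over $L^2(A;\mathsf k)$, with exponential vectors $\varepsilon(f)$, so that $\langle\varepsilon(f),\varepsilon(g)\rangle=e^{\langle f,g\rangle}$. Write $\mathcal F=\mathcal F_{\mathbb R_+}$, $\mathcal F_{t)}=\mathcal F_{[0,t)}$, $\mathcal F_{[t}=\mathcal F_{[t,\infty)}$, and identify $\mathcal F$ with $\mathcal F_{t)}\otimes\mathcal F_{[t}$ through $\varepsilon(f)\leftrightarrow\varepsilon(f|_{[0,t)})\otimes\varepsilon(f|_{[t,\infty)})$. For $t\in[0,\infty)$ let $\theta_t$ be the isometric right shift on $L^2(\mathbb R_+;\mathsf k)$ and let $\Gamma_t$ be its second quantization, $\Gamma_t\varepsilon(f)=\varepsilon(\theta_tf)$; let $\Gamma_\infty$ be the orthogonal projection onto $\mathbb C\varepsilon(0)$. For $X\in B(\mathcal F)$ let $\sigma_t(X)=I_{t)}\otimes\Gamma_tX\Gamma_t^*$ for $t\in[0,\infty)$, where $\Gamma_t$ is regarded as a unitary from $\mathcal F$ onto $\mathcal F_{[t}$,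 and let $\sigma_\infty(X)=I$. A quantum stop time is a map $S$ from the Borel sets of $[0,\infty]$ to $B(\mathcal F)$ such that every $S(A)$ is an orthogonal projection, $A\mapsto\langle x,S(A)y\rangle$ is a complex measure for all $x,y\in\mathcal F$, $S([0,\infty])=I$, $S(\{0\})\in\mathbb CI$, and $S([0,t])\in B(\mathcal F_{t)})\otimes I_{[t}$ for all $t\in(0,\infty)$. Let $S$ be a quantum stop time with $S(\{0\})=0$ that is finite, i.e. $S(\{\infty\})=0$. For a finite partition $\pi=\{0=\pi_0<\dots<\pi_{n+1}=\infty\}$ of $[0,\infty]$ put $$\sigma_{S,\pi}(X)=\sum_{j=1}^{n+1}\sigma_{\pi_j}(X)\,S((\pi_{j-1},\pi_j]),\qquad \Gamma_{S,\pi}=\sum_{j=1}^{n+1}S((\pi_{j-1},\pi_j])\,\Gamma_{\pi_j}.$$ All limits below are along the set of finite partitions directed by refinement. Then: 1. For every $\pi$, the map $\sigma_{S,\pi}:B(\mathcal F)\to B(\mathcal F)$ is unital, multiplicative and $*$-preserving, and $X\mapsto\sigma_{S,\pi}(X)-S((\pi_n,\infty])$ is a (linear, not necessarily unital) $*$-homomorphism.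 (Since $\sigma_\infty$ is constant, $\sigma_{S,\pi}$ itself is linear only if $S((\pi_n,\infty])=0$.) 2. For every $X\in B(\mathcal F)$ the strong limit $\sigma_S(X)=\lim_\pi\sigma_{S,\pi}(X)$ exists, and $\sigma_S:B(\mathcal F)\to B(\mathcal F)$ is a (linear) unital $*$-homomorphism. 3. The strong limit $\Gamma_S=\lim_\pi\Gamma_{S,\pi}$ exists and is an isometry, and $\sigma_S(X)\Gamma_S=\Gamma_SX$ for all $X\in B(\mathcal F)$. -/

import Mathlib

open scoped TensorProduct ENNReal NNReal Topology InnerProduct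
open MeasureTheory Filter

noncomputable section

namespace QStop

universe u

/-! ### Boson Fock space -/

section Fock

/-- A bundled complex inner product space, used only to define tensor powers by recursion. -/
structure InnerBundle : Type (u + 1) where
  carrier : Type u
  [grp : NormedAddCommGroup carrier]
  [ips : InnerProductSpace ℂ carrier]

attribute [instance] InnerBundle.grp InnerBundle.ips

variable (H : Type u) [NormedAddCommGroup H] [InnerProductSpace ℂ H]

/-- Algebraic tensor powers of `H`; the zeroth power is a one-dimensional space (in the universe
of `H`). -/
def tensorBundle : ℕ → InnerBundle.{u}
  | 0 => ⟨EuclideanSpace ℂ PUnit.{u + 1}⟩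
  | n + 1 => ⟨H ⊗[ℂ] (tensorBundle n).carrier⟩

/-- The algebraic tensor power `H ⊗ (H ⊗ ⋯)` with `n` factors. -/
abbrev TPow (n : ℕ) : Type u := (tensorBundle H n).carrier

/-- The full Fock space: the Hilbert space direct sum of the Hilbert space tensor powers of `H`. -/
abbrev FullFock : Type u := lp (fun n => UniformSpace.Completion (TPow H n)) 2

variable {H}

/-- `f ⊗ ⋯ ⊗ f` with `n` factors. -/
def tpow (f : H) : (n : ℕ) → TPow H n
  | 0 => (EuclideanSpace.single PUnit.unit (1 : ℂ) : EuclideanSpace ℂ PUnit.{u + 1})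
  | n + 1 => (f ⊗ₜ[ℂ] tpow f n : H ⊗[ℂ] TPow H n)

theorem inner_tpow (f g : H) (n : ℕ) : inner ℂ (tpow f n) (tpow g n) = inner ℂ f g ^ n := by
  induction n with
  | zero =>
    change inner ℂ (EuclideanSpace.single PUnit.unit (1 : ℂ) : EuclideanSpace ℂ PUnit.{u + 1})
      (EuclideanSpace.single PUnit.unit (1 : ℂ)) = _
    simp
  | succ n ih =>
    change inner ℂ (f ⊗ₜ[ℂ] tpow f n : H ⊗[ℂ] TPow H n) (g ⊗ₜ[ℂ] tpow g n) = _
    rw [TensorProduct.inner_tmul, ih, pow_succ']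

theorem norm_tpow (f : H) (n : ℕ) : ‖tpow f n‖ = ‖f‖ ^ n := by
  have h := inner_tpow f f n
  rw [inner_self_eq_norm_sq_to_K, inner_self_eq_norm_sq_to_K] at h
  have h2 : ‖tpow f n‖ ^ 2 = (‖f‖ ^ n) ^ 2 := by
    rw [← pow_mul, mul_comm n 2, pow_mul]
    exact_mod_cast h
  exact (pow_left_inj₀ (norm_nonneg _) (by positivity) two_ne_zero).1 h2

/-- The degree `n` component `f^{⊗ n} / √(n!)` of the exponential vector of `f`. -/
def expTerm (f : H) (n : ℕ) : UniformSpace.Completion (TPow H n) :=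
  (((Real.sqrt (n.factorial : ℝ))⁻¹ : ℝ) : ℂ) • (tpow f n : UniformSpace.Completion (TPow H n))

theorem inner_expTerm (f g : H) (n : ℕ) :
    inner ℂ (expTerm f n) (expTerm g n) = (n.factorial : ℂ)⁻¹ * inner ℂ f g ^ n := by
  unfold expTerm
  rw [inner_smul_left, inner_smul_right, UniformSpace.Completion.inner_coe, inner_tpow,
    Complex.conj_ofReal, ← mul_assoc, ← Complex.ofReal_mul, ← mul_inv,
    Real.mul_self_sqrt (by positivity)]
  push_cast
  rfl

theorem norm_expTerm_sq (f : H) (n : ℕ) :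
    ‖expTerm f n‖ ^ 2 = (n.factorial : ℝ)⁻¹ * (‖f‖ ^ 2) ^ n := by
  have h := inner_expTerm f f n
  rw [inner_self_eq_norm_sq_to_K, inner_self_eq_norm_sq_to_K] at h
  refine Complex.ofReal_injective ?_
  push_cast
  exact h

theorem memℓp_expTerm (f : H) : Memℓp (expTerm f) 2 := by
  rw [memℓp_gen_iff (by norm_num)]
  have : Summable fun n : ℕ => (n.factorial : ℝ)⁻¹ * (‖f‖ ^ 2) ^ n := by
    simpa [div_eq_inv_mul] using Real.summable_pow_div_factorial (‖f‖ ^ 2)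
  refine this.congr fun n => ?_
  rw [← norm_expTerm_sq]
  simp

/-- The exponential vector of `f` in the full Fock space. -/
def fullExp (f : H) : FullFock H := ⟨expTerm f, memℓp_expTerm f⟩

theorem inner_fullExp (f g : H) :
    inner ℂ (fullExp f) (fullExp g) = Complex.exp (inner ℂ f g) := by
  rw [lp.inner_eq_tsum, Complex.exp_eq_exp_ℂ, NormedSpace.exp_eq_tsum_div]
  refine tsum_congr fun n => ?_
  change inner ℂ (expTerm f n) (expTerm g n) = _
  rw [inner_expTerm, div_eq_inv_mul]

variable (H) in
/-- Boson (symmetric) Fock space over `H`: the closed linear span of the exponential vectors in the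
full Fock space. -/
def fockSubspace : Submodule ℂ (FullFock H) :=
  (Submodule.span ℂ (Set.range (fullExp (H := H)))).topologicalClosure

variable (H) in
/-- Boson (symmetric) Fock space over `H`, as a Hilbert space. -/
def Fock : Type u := fockSubspace H

instance : NormedAddCommGroup (Fock H) := inferInstanceAs (NormedAddCommGroup (fockSubspace H))

instance : InnerProductSpace ℂ (Fock H) := inferInstanceAs (InnerProductSpace ℂ (fockSubspace H))

variable (H) in
/-- The inclusion of the Boson Fock space in the full Fock space. -/
def fockIncl : Fock H →ₗᵢ[ℂ] FullFock H := (fockSubspace H).subtypeₗᵢ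

instance : CompleteSpace (Fock H) :=
  (Submodule.isClosed_topologicalClosure _).completeSpace_coe

/-- The exponential vector `ε(f)`. -/
def ev (f : H) : Fock H :=
  ⟨fullExp f, Submodule.le_topologicalClosure _ (Submodule.subset_span ⟨f, rfl⟩)⟩

theorem inner_ev (f g : H) : inner ℂ (ev f) (ev g) = Complex.exp (inner ℂ f g) :=
  inner_fullExp f g

theorem span_ev_dense :
    (Submodule.span ℂ (Set.range (ev (H := H)))).topologicalClosure = ⊤ := by
  rw [Submodule.eq_top_iff']
  intro x
  rw [← SetLike.mem_coe, Submodule.topologicalClosure_coe,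
    (fockIncl H).isometry.isEmbedding.closure_eq_preimage_closure_image]
  have hx : fockIncl H x ∈ closure
      (Submodule.span ℂ (Set.range (fullExp (H := H))) : Set (FullFock H)) := by
    rw [← Submodule.topologicalClosure_coe]; exact x.2
  have h : (Submodule.span ℂ (Set.range (ev (H := H)))).map (fockIncl H).toLinearMap =
      Submodule.span ℂ (Set.range (fullExp (H := H))) := by
    rw [Submodule.map_span, ← Set.range_comp]; rfl
  rw [← h] at hx
  exact hx

end Fock

/-! ### Isometries determined by Gram matrices -/

section Ext

variable {ι E G : Type*} [NormedAddCommGroup E] [InnerProductSpace ℂ E]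
  [NormedAddCommGroup G] [InnerProductSpace ℂ G]

theorem norm_linearCombination_eq (a : ι → E) (b : ι → G)
    (h : ∀ i j, inner ℂ (b i) (b j) = inner ℂ (a i) (a j)) (c : ι →₀ ℂ) :
    ‖Finsupp.linearCombination ℂ b c‖ = ‖Finsupp.linearCombination ℂ a c‖ := by
  have key : inner ℂ (Finsupp.linearCombination ℂ b c) (Finsupp.linearCombination ℂ b c) =
      inner ℂ (Finsupp.linearCombination ℂ a c) (Finsupp.linearCombination ℂ a c) := by
    simp only [Finsupp.linearCombination_apply, Finsupp.sum, sum_inner, inner_sum,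
      inner_smul_left, inner_smul_right, h]
  rw [inner_self_eq_norm_sq_to_K, inner_self_eq_norm_sq_to_K] at key
  exact (pow_left_inj₀ (norm_nonneg _) (norm_nonneg _) two_ne_zero).1 (by exact_mod_cast key)

theorem denseRange_linearCombination (a : ι → E)
    (ha : (Submodule.span ℂ (Set.range a)).topologicalClosure = ⊤) :
    DenseRange (Finsupp.linearCombination ℂ a) := by
  rw [DenseRange, dense_iff_closure_eq, ← LinearMap.coe_range, Finsupp.range_linearCombination,
    ← Submodule.topologicalClosure_coe, ha, Submodule.top_coe]

variable [CompleteSpace G]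

/-- Given a total family `a` in `E` and a family `b` in `G` with the same inner products, the
linear isometry `E → G` that maps `a i` to `b i` for all `i`. -/
def isoExt (a : ι → E) (ha : (Submodule.span ℂ (Set.range a)).topologicalClosure = ⊤)
    (b : ι → G) (h : ∀ i j, inner ℂ (b i) (b j) = inner ℂ (a i) (a j)) : E →ₗᵢ[ℂ] G where
  toLinearMap := ((Finsupp.linearCombination ℂ b).extendOfNorm
    (Finsupp.linearCombination ℂ a)).toLinearMap
  norm_map' := by
    have hd := denseRange_linearCombination a ha
    refine hd.induction ?_ (isClosed_eq (by
      simp only [ContinuousLinearMap.coe_coe]; fun_prop) continuous_norm)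
    rintro _ ⟨c, rfl⟩
    rw [ContinuousLinearMap.coe_coe, LinearMap.extendOfNorm_eq hd
      ⟨1, fun x => by rw [norm_linearCombination_eq a b h, one_mul]⟩]
    exact norm_linearCombination_eq a b h c

theorem isoExt_apply (a : ι → E) (ha : (Submodule.span ℂ (Set.range a)).topologicalClosure = ⊤)
    (b : ι → G) (h : ∀ i j, inner ℂ (b i) (b j) = inner ℂ (a i) (a j)) (i : ι) :
    isoExt a ha b h (a i) = b i := by
  have := LinearMap.extendOfNorm_eq (denseRange_linearCombination a ha)
      (f := Finsupp.linearCombination ℂ b)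
      ⟨1, fun x => by rw [norm_linearCombination_eq a b h, one_mul]⟩ (Finsupp.single i 1)
  rw [Finsupp.linearCombination_single, Finsupp.linearCombination_single, one_smul,
    one_smul] at this
  exact this

/-- If `b` is total as well, the isometry is onto. -/
def isoExtEquiv [CompleteSpace E] (a : ι → E)
    (ha : (Submodule.span ℂ (Set.range a)).topologicalClosure = ⊤)
    (b : ι → G) (hb : (Submodule.span ℂ (Set.range b)).topologicalClosure = ⊤)
    (h : ∀ i j, inner ℂ (b i) (b j) = inner ℂ (a i) (a j)) : E ≃ₗᵢ[ℂ] G :=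
  LinearIsometryEquiv.ofSurjective (isoExt a ha b h) (by
    have hc : IsClosed (Set.range (isoExt a ha b h)) :=
      (isoExt a ha b h).isometry.isClosedEmbedding.isClosed_range
    rw [← Set.range_eq_univ, ← hc.closure_eq, ← dense_iff_closure_eq]
    refine (denseRange_linearCombination b hb).mono ?_
    rintro _ ⟨c, rfl⟩
    refine ⟨Finsupp.linearCombination ℂ a c, ?_⟩
    rw [← LinearIsometry.coe_toLinearMap, Finsupp.apply_linearCombination]
    congr 2
    ext i
    exact isoExt_apply a ha b h i)

theorem isoExtEquiv_apply [CompleteSpace E] (a : ι → E)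
    (ha : (Submodule.span ℂ (Set.range a)).topologicalClosure = ⊤)
    (b : ι → G) (hb : (Submodule.span ℂ (Set.range b)).topologicalClosure = ⊤)
    (h : ∀ i j, inner ℂ (b i) (b j) = inner ℂ (a i) (a j)) (i : ι) :
    isoExtEquiv a ha b hb h (a i) = b i := isoExt_apply a ha b h i

end Ext

section SecondQuantization

variable {H K : Type*} [NormedAddCommGroup H] [InnerProductSpace ℂ H]
  [NormedAddCommGroup K] [InnerProductSpace ℂ K]

/-- Second quantization of an isometry: `ε(f) ↦ ε(V f)`. -/
def secondQuant (V : H →ₗᵢ[ℂ] K) : Fock H →ₗᵢ[ℂ] Fock K :=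
  isoExt ev span_ev_dense (fun f => ev (V f)) (fun f g => by
    rw [inner_ev, inner_ev, V.inner_map_map])

theorem secondQuant_ev (V : H →ₗᵢ[ℂ] K) (f : H) : secondQuant V (ev f) = ev (V f) :=
  isoExt_apply _ _ _ _ f

/-- Second quantization of a unitary: `ε(f) ↦ ε(U f)`. -/
def secondQuantEquiv (U : H ≃ₗᵢ[ℂ] K) : Fock H ≃ₗᵢ[ℂ] Fock K :=
  isoExtEquiv ev span_ev_dense (fun f => ev (U f))
    (by rw [show Set.range (fun f => ev (U f)) = Set.range (ev (H := K)) from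
      U.surjective.range_comp ev]; exact span_ev_dense)
    (fun f g => by rw [inner_ev, inner_ev, U.inner_map_map])

theorem secondQuantEquiv_ev (U : H ≃ₗᵢ[ℂ] K) (f : H) : secondQuantEquiv U (ev f) = ev (U f) :=
  isoExtEquiv_apply _ _ _ _ _ f

end SecondQuantization

/-! ### Hilbert space tensor products -/

section Tensor

variable (E G : Type*) [NormedAddCommGroup E] [InnerProductSpace ℂ E]
  [NormedAddCommGroup G] [InnerProductSpace ℂ G]

/-- The Hilbert space tensor product of `E` and `G`. -/
abbrev HTensor : Type _ := UniformSpace.Completion (E ⊗[ℂ] G)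

variable {E G}

/-- The elementary tensor `x ⊗ y`. -/
def htmul (x : E) (y : G) : HTensor E G := ((x ⊗ₜ[ℂ] y : E ⊗[ℂ] G) : HTensor E G)

theorem inner_htmul (x x' : E) (y y' : G) :
    inner ℂ (htmul x y) (htmul x' y') = inner ℂ x x' * inner ℂ y y' := by
  unfold htmul
  rw [UniformSpace.Completion.inner_coe, TensorProduct.inner_tmul]

variable (G) in
/-- The ampliation `A ⊗ I` on the Hilbert space tensor product. -/
def ampLeft (A : E →L[ℂ] E) : HTensor E G →L[ℂ] HTensor E G := (A.rTensor G).completion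

variable (E) in
/-- The ampliation `I ⊗ B` on the Hilbert space tensor product. -/
def ampRight (B : G →L[ℂ] G) : HTensor E G →L[ℂ] HTensor E G := (B.lTensor E).completion

end Tensor

/-! ### Fock space over `L²(ℝ₊; k)` -/

section L2

/-- Lebesgue measure on the half-line `ℝ₊ = [0, ∞)`. -/
def lam : Measure ℝ := volume.restrict (Set.Ici 0)

variable (k : Type u) [NormedAddCommGroup k] [InnerProductSpace ℂ k]

/-- `L²(ℝ₊; k)`. -/
abbrev L2 : Type u := Lp k 2 lam

/-- `L²(A; k)` for `A ⊆ ℝ₊`. -/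
abbrev L2On (A : Set ℝ) : Type u := Lp k 2 (lam.restrict A)

variable {k}

/-- Restriction `f ↦ f|_A` from `L²(ℝ₊; k)` to `L²(A; k)`. -/
def resL2 (A : Set ℝ) : L2 k →L[ℂ] L2On k A := LpToLpRestrictCLM ℝ k ℂ lam 2 A

theorem lam_ae_nonneg : ∀ᵐ s ∂lam, (0 : ℝ) ≤ s := ae_restrict_mem measurableSet_Ici

theorem lam_restrict_compl (t : ℝ≥0) :
    lam.restrict (Set.Ico 0 (t : ℝ))ᶜ = lam.restrict (Set.Ici (t : ℝ)) := by
  refine Measure.restrict_congr_set ?_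
  filter_upwards [lam_ae_nonneg] with s hs
  refine propext ⟨fun h => ?_, fun h h' => ?_⟩
  · by_contra h2
    exact h ⟨hs, not_le.1 h2⟩
  · exact absurd h (not_le.2 h'.2)

theorem inner_resL2 (f g : L2 k) (A : Set ℝ) :
    inner ℂ (resL2 A f) (resL2 A g) = ∫ s in A, inner ℂ (f s) (g s) ∂lam := by
  rw [L2.inner_def]
  refine integral_congr_ae ?_
  filter_upwards [LpToLpRestrictCLM_coeFn ℂ A f, LpToLpRestrictCLM_coeFn ℂ A g] with s h1 h2
  simp only [resL2, h1, h2]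

theorem inner_split (t : ℝ≥0) (f g : L2 k) :
    inner ℂ (resL2 (Set.Ico 0 (t : ℝ)) f) (resL2 (Set.Ico 0 (t : ℝ)) g) +
      inner ℂ (resL2 (Set.Ici (t : ℝ)) f) (resL2 (Set.Ici (t : ℝ)) g) = inner ℂ f g := by
  rw [inner_resL2, inner_resL2, ← lam_restrict_compl, L2.inner_def]
  exact integral_add_compl measurableSet_Ico (L2.integrable_inner f g)

theorem exists_glue (t : ℝ≥0) (f : L2On k (Set.Ico 0 (t : ℝ))) (g : L2On k (Set.Ici (t : ℝ))) :
    ∃ h : L2 k, resL2 (Set.Ico 0 (t : ℝ)) h = f ∧ resL2 (Set.Ici (t : ℝ)) h = g := by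
  have hf : MemLp ((Set.Ico 0 (t : ℝ)).indicator f) 2 lam :=
    (memLp_indicator_iff_restrict measurableSet_Ico).2 (Lp.memLp f)
  have hg : MemLp ((Set.Ici (t : ℝ)).indicator g) 2 lam :=
    (memLp_indicator_iff_restrict measurableSet_Ici).2 (Lp.memLp g)
  refine ⟨(hf.add hg).toLp _, ?_, ?_⟩
  · refine Lp.ext ?_
    filter_upwards [LpToLpRestrictCLM_coeFn ℂ (Set.Ico 0 (t : ℝ)) ((hf.add hg).toLp _),
      ae_restrict_of_ae (hf.add hg).coeFn_toLp, ae_restrict_mem measurableSet_Ico] with s h1 h2 h3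
    rw [resL2, h1, h2, Pi.add_apply, Set.indicator_of_mem h3,
      Set.indicator_of_notMem (by simpa using h3.2), add_zero]
  · refine Lp.ext ?_
    filter_upwards [LpToLpRestrictCLM_coeFn ℂ (Set.Ici (t : ℝ)) ((hf.add hg).toLp _),
      ae_restrict_of_ae (hf.add hg).coeFn_toLp, ae_restrict_mem measurableSet_Ici] with s h1 h2 h3
    rw [resL2, h1, h2, Pi.add_apply, Set.indicator_of_mem h3,
      Set.indicator_of_notMem (fun h => absurd h.2 (not_lt.2 h3)), zero_add]

theorem span_htmul_ev_dense (H K : Type*) [NormedAddCommGroup H] [InnerProductSpace ℂ H]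
    [NormedAddCommGroup K] [InnerProductSpace ℂ K] :
    (Submodule.span ℂ (Set.range fun p : H × K => htmul (ev p.1) (ev p.2))).topologicalClosure
      = ⊤ := by
  set M := (Submodule.span ℂ
    (Set.range fun p : H × K => htmul (ev p.1) (ev p.2))).topologicalClosure with hM
  have hMc : IsClosed (M : Set (HTensor (Fock H) (Fock K))) :=
    Submodule.isClosed_topologicalClosure _
  have c1 : ∀ y : Fock K, Continuous fun x : Fock H => htmul x y := fun y =>
    (UniformSpace.Completion.continuous_coe _).comp
      (TensorProduct.continuous_tmul.comp (by fun_prop : Continuous fun x : Fock H => (x, y)))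
  have c2 : ∀ x : Fock H, Continuous fun y : Fock K => htmul x y := fun x =>
    (UniformSpace.Completion.continuous_coe _).comp
      (TensorProduct.continuous_tmul.comp (by fun_prop : Continuous fun y : Fock K => (x, y)))
  have a1 : ∀ (x x' : Fock H) (y : Fock K), htmul (x + x') y = htmul x y + htmul x' y := by
    intro x x' y; simp [htmul, TensorProduct.add_tmul, UniformSpace.Completion.coe_add]
  have a2 : ∀ (x : Fock H) (y y' : Fock K), htmul x (y + y') = htmul x y + htmul x y' := by
    intro x x' y; simp [htmul, TensorProduct.tmul_add, UniformSpace.Completion.coe_add]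
  have m1 : ∀ (c : ℂ) (x : Fock H) (y : Fock K), htmul (c • x) y = c • htmul x y := by
    intro c x y
    exact UniformSpace.Completion.coe_smul c (x ⊗ₜ[ℂ] y : Fock H ⊗[ℂ] Fock K)
  have m2 : ∀ (c : ℂ) (x : Fock H) (y : Fock K), htmul x (c • y) = c • htmul x y := by
    intro c x y
    unfold htmul
    rw [TensorProduct.tmul_smul]
    exact UniformSpace.Completion.coe_smul c (x ⊗ₜ[ℂ] y : Fock H ⊗[ℂ] Fock K)
  have z1 : ∀ (y : Fock K), htmul (0 : Fock H) y = 0 := by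
    intro y; rw [htmul, TensorProduct.zero_tmul, UniformSpace.Completion.coe_zero]
  have z2 : ∀ (x : Fock H), htmul x (0 : Fock K) = 0 := by
    intro x; rw [htmul, TensorProduct.tmul_zero, UniformSpace.Completion.coe_zero]
  have s0 : ∀ f g, htmul (ev f) (ev g) ∈ M := fun f g =>
    Submodule.le_topologicalClosure _ (Submodule.subset_span ⟨(f, g), rfl⟩)
  have s1 : ∀ (x : Fock H) (g : K), htmul x (ev g) ∈ M := by
    intro x g
    have dense_H : x ∈ closure (Submodule.span ℂ (Set.range (ev (H := H))) : Set (Fock H)) := by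
      rw [← Submodule.topologicalClosure_coe, span_ev_dense]; trivial
    refine closure_minimal (t := (fun x : Fock H => htmul x (ev g)) ⁻¹' M) ?_
      (hMc.preimage (c1 _)) dense_H
    intro y hy
    induction hy using Submodule.span_induction with
    | mem y hy => obtain ⟨f, rfl⟩ := hy; exact s0 f g
    | zero => change htmul _ _ ∈ M; rw [z1]; exact M.zero_mem
    | add y y' _ _ h1 h2 => change htmul _ _ ∈ M; rw [a1]; exact M.add_mem h1 h2
    | smul c y _ h1 => change htmul _ _ ∈ M; rw [m1]; exact M.smul_mem c h1
  have s2 : ∀ (x : Fock H) (y : Fock K), htmul x y ∈ M := by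
    intro x y
    have dense_K : y ∈ closure (Submodule.span ℂ (Set.range (ev (H := K))) : Set (Fock K)) := by
      rw [← Submodule.topologicalClosure_coe, span_ev_dense]; trivial
    refine closure_minimal (t := (fun y : Fock K => htmul x y) ⁻¹' M) ?_
      (hMc.preimage (c2 _)) dense_K
    intro y hy
    induction hy using Submodule.span_induction with
    | mem y hy => obtain ⟨f, rfl⟩ := hy; exact s1 x f
    | zero => change htmul _ _ ∈ M; rw [z2]; exact M.zero_mem
    | add y y' _ _ h1 h2 => change htmul _ _ ∈ M; rw [a2]; exact M.add_mem h1 h2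
    | smul c y _ h1 => change htmul _ _ ∈ M; rw [m2]; exact M.smul_mem c h1
  rw [Submodule.eq_top_iff']
  intro z
  refine UniformSpace.Completion.induction_on z hMc fun w => ?_
  induction w using TensorProduct.induction_on with
  | zero => rw [UniformSpace.Completion.coe_zero]; exact M.zero_mem
  | tmul x y => exact s2 x y
  | add x y hx hy => rw [UniformSpace.Completion.coe_add]; exact M.add_mem hx hy

variable (k)

/-- The Fock space `F` over `L²(ℝ₊; k)`. -/
abbrev F : Type u := Fock (L2 k)

/-- The Fock space `F_{t)}` over `L²([0, t); k)`. -/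
abbrev FPre (t : ℝ≥0) : Type u := Fock (L2On k (Set.Ico 0 (t : ℝ)))

/-- The Fock space `F_{[t}` over `L²([t, ∞); k)`. -/
abbrev FPost (t : ℝ≥0) : Type u := Fock (L2On k (Set.Ici (t : ℝ)))

/-- The tensor product decomposition `F ≅ F_{t)} ⊗ F_{[t}`, with
`ε(f) ↦ ε(f|_{[0, t)}) ⊗ ε(f|_{[t, ∞)})`. -/
def split (t : ℝ≥0) : F k ≃ₗᵢ[ℂ] HTensor (FPre k t) (FPost k t) :=
  isoExtEquiv ev span_ev_dense
    (fun f => htmul (ev (resL2 (Set.Ico 0 (t : ℝ)) f)) (ev (resL2 (Set.Ici (t : ℝ)) f)))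
    (by
      rw [← span_htmul_ev_dense]
      congr 2
      ext z
      constructor
      · rintro ⟨f, rfl⟩
        exact ⟨(_, _), rfl⟩
      · rintro ⟨⟨f, g⟩, rfl⟩
        obtain ⟨h, h1, h2⟩ := exists_glue t f g
        exact ⟨h, by simp only [h1, h2]⟩)
    (fun f g => by
      rw [inner_htmul, inner_ev, inner_ev, inner_ev, ← Complex.exp_add, inner_split])

theorem split_ev (t : ℝ≥0) (f : L2 k) :
    split k t (ev f) =
      htmul (ev (resL2 (Set.Ico 0 (t : ℝ)) f)) (ev (resL2 (Set.Ici (t : ℝ)) f)) :=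
  isoExtEquiv_apply _ _ _ _ _ f

end L2

/-! ### Shifts and the CCR flow -/

section Shift

theorem lam_restrict_Ici (t : ℝ≥0) :
    lam.restrict (Set.Ici (t : ℝ)) = volume.restrict (Set.Ici (t : ℝ)) := by
  rw [lam, Measure.restrict_restrict measurableSet_Ici]
  congr 1
  exact Set.inter_eq_left.2 (Set.Ici_subset_Ici.2 t.2)

theorem measurePreserving_sub (t : ℝ≥0) :
    MeasurePreserving (fun s : ℝ => s - t) (lam.restrict (Set.Ici (t : ℝ))) lam := by
  have h := (measurePreserving_sub_right (volume : Measure ℝ) (t : ℝ)).restrict_preimage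
    (measurableSet_Ici (a := (0 : ℝ)))
  have e : (fun s : ℝ => s - t) ⁻¹' Set.Ici 0 = Set.Ici (t : ℝ) := by ext s; simp
  rw [e] at h
  rw [lam_restrict_Ici, lam]
  exact h

theorem measurePreserving_add (t : ℝ≥0) :
    MeasurePreserving (fun s : ℝ => s + t) lam (lam.restrict (Set.Ici (t : ℝ))) := by
  have h := (measurePreserving_add_right (volume : Measure ℝ) (t : ℝ)).restrict_preimage
    (measurableSet_Ici (a := (t : ℝ)))
  have e : (fun s : ℝ => s + t) ⁻¹' Set.Ici (t : ℝ) = Set.Ici 0 := by ext s; simp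
  rw [e] at h
  rw [lam_restrict_Ici, lam]
  exact h

variable (k : Type u) [NormedAddCommGroup k] [InnerProductSpace ℂ k]

/-- The right shift as a unitary from `L²(ℝ₊; k)` onto `L²([t, ∞); k)`: `f ↦ f(· - t)`. -/
def shiftOnto (t : ℝ≥0) : L2 k ≃ₗᵢ[ℂ] L2On k (Set.Ici (t : ℝ)) :=
  LinearIsometryEquiv.ofSurjective
    (Lp.compMeasurePreservingₗᵢ ℂ (fun s : ℝ => s - t) (measurePreserving_sub t)) (by
      intro g
      refine ⟨Lp.compMeasurePreserving (fun s : ℝ => s + t) (measurePreserving_add t) g, ?_⟩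
      refine Lp.ext ?_
      refine (Lp.coeFn_compMeasurePreserving _ (measurePreserving_sub t)).trans ?_
      have h := (measurePreserving_sub t).quasiMeasurePreserving.ae_eq_comp
        (Lp.coeFn_compMeasurePreserving g (measurePreserving_add t))
      refine h.trans (Eventually.of_forall fun s => ?_)
      simp)

variable {k} in
/-- Extension by zero from `L²([t, ∞); k)` to `L²(ℝ₊; k)`. -/
def extZero (t : ℝ≥0) (g : L2On k (Set.Ici (t : ℝ))) : L2 k :=
  ((memLp_indicator_iff_restrict measurableSet_Ici).2 (Lp.memLp g)).toLp
    ((Set.Ici (t : ℝ)).indicator g)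

variable {k} in
theorem extZero_coeFn (t : ℝ≥0) (g : L2On k (Set.Ici (t : ℝ))) :
    extZero t g =ᵐ[lam] (Set.Ici (t : ℝ)).indicator g := MemLp.coeFn_toLp _

variable {k} in
theorem ae_of_restrict_Ici {t : ℝ≥0} {p : ℝ → Prop}
    (h : ∀ᵐ s ∂lam.restrict (Set.Ici (t : ℝ)), p s) : ∀ᵐ s ∂lam, s ∈ Set.Ici (t : ℝ) → p s :=
  (ae_restrict_iff' measurableSet_Ici).1 h

/-- The isometric right shift `θ_t` on `L²(ℝ₊; k)`: `(θ_t f)(s) = f(s - t)` if `s ≥ t`, and `0`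
otherwise. -/
def shift (t : ℝ≥0) : L2 k →ₗᵢ[ℂ] L2 k where
  toFun f := extZero t (shiftOnto k t f)
  map_add' f g := by
    rw [map_add]
    refine Lp.ext ?_
    filter_upwards [extZero_coeFn t (shiftOnto k t f + shiftOnto k t g),
      extZero_coeFn t (shiftOnto k t f), extZero_coeFn t (shiftOnto k t g),
      Lp.coeFn_add (extZero t (shiftOnto k t f)) (extZero t (shiftOnto k t g)),
      ae_of_restrict_Ici (Lp.coeFn_add (shiftOnto k t f) (shiftOnto k t g))] with s h1 h2 h3 h4 h5
    rw [h1, h4, Pi.add_apply, h2, h3]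
    by_cases hs : s ∈ Set.Ici (t : ℝ)
    · simp only [Set.indicator_of_mem hs, h5 hs, Pi.add_apply]
    · simp only [Set.indicator_of_notMem hs, add_zero]
  map_smul' c f := by
    rw [map_smul]
    refine Lp.ext ?_
    filter_upwards [extZero_coeFn t (c • shiftOnto k t f), extZero_coeFn t (shiftOnto k t f),
      Lp.coeFn_smul c (extZero t (shiftOnto k t f)),
      ae_of_restrict_Ici (Lp.coeFn_smul c (shiftOnto k t f))] with s h1 h2 h3 h4
    rw [RingHom.id_apply, h1, h3, Pi.smul_apply, h2]
    by_cases hs : s ∈ Set.Ici (t : ℝ)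
    · simp only [Set.indicator_of_mem hs, h4 hs, Pi.smul_apply]
    · simp only [Set.indicator_of_notMem hs, smul_zero]
  norm_map' f := by
    change ‖extZero t (shiftOnto k t f)‖ = ‖f‖
    rw [← (shiftOnto k t).norm_map f, extZero, Lp.norm_toLp,
      eLpNorm_indicator_eq_eLpNorm_restrict measurableSet_Ici, Lp.norm_def]

theorem shift_coeFn (t : ℝ≥0) (f : L2 k) :
    shift k t f =ᵐ[lam] fun s => if (t : ℝ) ≤ s then f (s - t) else 0 := by
  filter_upwards [extZero_coeFn t (shiftOnto k t f),
    ae_of_restrict_Ici (Lp.coeFn_compMeasurePreserving f (measurePreserving_sub t))] with s h1 h2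
  change extZero t (shiftOnto k t f) s = _
  rw [h1]
  by_cases hs : (t : ℝ) ≤ s
  · rw [Set.indicator_of_mem (Set.mem_Ici.2 hs), if_pos hs]
    exact h2 hs
  · rw [Set.indicator_of_notMem (by simpa using hs), if_neg hs]

/-- `E_0`: the orthogonal projection of `F` onto the vacuum line `ℂ ε(0)`. -/
def vacProj : F k →L[ℂ] F k := (ℂ ∙ (ev (0 : L2 k))).starProjection

/-- The second-quantized right shift `Γ_t : F → F`, `ε(f) ↦ ε(θ_t f)`, for `t ∈ [0, ∞)`, together
with `Γ_∞ = E_0`. -/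
def Gam (t : ℝ≥0∞) : F k →L[ℂ] F k :=
  if t = ∞ then vacProj k else (secondQuant (shift k t.toNNReal)).toContinuousLinearMap

/-- `Γ_t` regarded as a unitary from `F` onto `F_{[t}`. -/
def GamOnto (t : ℝ≥0) : F k ≃ₗᵢ[ℂ] FPost k t := secondQuantEquiv (shiftOnto k t)

variable {k}

/-- `A ⊗ I_{[t}` as an operator on `F ≅ F_{t)} ⊗ F_{[t}`. -/
def preOp (t : ℝ≥0) (A : FPre k t →L[ℂ] FPre k t) : F k →L[ℂ] F k :=
  ((split k t).symm : HTensor (FPre k t) (FPost k t) →L[ℂ] F k) ∘L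
    ampLeft (FPost k t) A ∘L (split k t : F k →L[ℂ] HTensor (FPre k t) (FPost k t))

/-- `I_{t)} ⊗ B` as an operator on `F ≅ F_{t)} ⊗ F_{[t}`. -/
def postOp (t : ℝ≥0) (B : FPost k t →L[ℂ] FPost k t) : F k →L[ℂ] F k :=
  ((split k t).symm : HTensor (FPre k t) (FPost k t) →L[ℂ] F k) ∘L
    ampRight (FPre k t) B ∘L (split k t : F k →L[ℂ] HTensor (FPre k t) (FPost k t))

/-- The CCR flow: `σ_t(X) = I_{t)} ⊗ Γ_t X Γ_t^*` for `t ∈ [0, ∞)`. -/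
def ccrFlow (t : ℝ≥0) (X : F k →L[ℂ] F k) : F k →L[ℂ] F k :=
  postOp t ((GamOnto k t : F k →L[ℂ] FPost k t) ∘L X ∘L
    ((GamOnto k t).symm : FPost k t →L[ℂ] F k))

/-- The CCR flow extended to `t ∈ [0, ∞]` by `σ_∞(X) = I`. -/
def ccr (t : ℝ≥0∞) (X : F k →L[ℂ] F k) : F k →L[ℂ] F k :=
  if t = ∞ then 1 else ccrFlow t.toNNReal X

end Shift

/-! ### Quantum stop times -/

section StopTime

variable (k : Type u) [NormedAddCommGroup k] [InnerProductSpace ℂ k] [CompleteSpace k]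

/-- A quantum stop time: an identity-adapted spectral measure on the Borel sets of `[0, ∞]`.
(The values of `toFun` at sets that are not Borel play no role.) -/
structure QuantumStopTime where
  /-- `A ↦ S(A)` -/
  toFun : Set ℝ≥0∞ → F k →L[ℂ] F k
  isProj : ∀ A, MeasurableSet A → IsStarProjection (toFun A)
  isMeasure : ∀ x y : F k, ∃ μ : ComplexMeasure ℝ≥0∞,
    ∀ A, MeasurableSet A → μ A = inner ℂ x (toFun A y)
  map_univ : toFun Set.univ = 1
  adapted_zero : ∃ c : ℂ, toFun {0} = c • (1 : F k →L[ℂ] F k)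
  adapted : ∀ t : ℝ≥0, 0 < t → ∃ A : FPre k t →L[ℂ] FPre k t,
    toFun (Set.Icc 0 (t : ℝ≥0∞)) = preOp t A

/-- A finite quantum stop time: `S({0}) = 0` (the trivial case of stopping immediately at time `0`
is excluded throughout) and `S({∞}) = 0`. -/
structure QuantumStopTime.IsFinite {k : Type u} [NormedAddCommGroup k] [InnerProductSpace ℂ k]
    [CompleteSpace k] (S : QuantumStopTime k) : Prop where
  zero : S.toFun {0} = 0
  top : S.toFun {∞} = 0

end StopTime

/-! ### Finite partitions of `[0, ∞]` and Riemann sums -/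

section Riemann

/-- A finite partition `0 = π_0 < ⋯ < π_{n+1} = ∞` of `[0, ∞]`. -/
structure TimePartition where
  n : ℕ
  pt : Fin (n + 2) → ℝ≥0∞
  strictMono : StrictMono pt
  pt_zero : pt 0 = 0
  pt_last : pt (Fin.last (n + 1)) = ∞

/-- Partitions are ordered by refinement: `π ≤ π'` if every point of `π` is a point of `π'`. -/
instance : Preorder TimePartition where
  le p q := Set.range p.pt ⊆ Set.range q.pt
  le_refl _ := subset_rfl
  le_trans _ _ _ := Set.Subset.trans

/-- Every finite subset of `[0, ∞]` that contains `0` and `∞` is a partition. -/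
theorem TimePartition.exists_of_finset (s : Finset ℝ≥0∞) (h0 : 0 ∈ s) (h1 : ∞ ∈ s) :
    ∃ p : TimePartition, Set.range p.pt = s := by
  have hc : 1 < s.card := Finset.one_lt_card.2 ⟨0, h0, ∞, h1, by simp⟩
  obtain ⟨n, hn⟩ : ∃ n, s.card = n + 2 := ⟨s.card - 2, by omega⟩
  refine ⟨⟨n, s.orderEmbOfFin hn, (s.orderEmbOfFin hn).strictMono, ?_, ?_⟩,
    Finset.range_orderEmbOfFin s hn⟩
  · have h := Finset.orderEmbOfFin_zero hn (by omega)
    rw [show (0 : Fin (n + 2)) = ⟨0, by omega⟩ from rfl, h]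
    exact le_antisymm (Finset.min'_le _ _ h0) bot_le
  · have h := Finset.orderEmbOfFin_last hn (by omega)
    rw [show Fin.last (n + 1) = ⟨n + 2 - 1, by omega⟩ from rfl, h]
    exact le_antisymm le_top (Finset.le_max' _ _ h1)

instance : Nonempty TimePartition :=
  ⟨(TimePartition.exists_of_finset {0, ∞} (by simp) (by simp)).choose⟩

instance : IsDirectedOrder TimePartition where
  directed p q := by
    classical
    obtain ⟨r, hr⟩ := TimePartition.exists_of_finset
      (Finset.univ.image p.pt ∪ Finset.univ.image q.pt)
      (by simp only [Finset.mem_union, Finset.mem_image]; exact .inl ⟨0, by simp, p.pt_zero⟩)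
      (by simp only [Finset.mem_union, Finset.mem_image]; exact .inl ⟨_, by simp, p.pt_last⟩)
    refine ⟨r, ?_, ?_⟩
    · change Set.range p.pt ⊆ Set.range r.pt
      rw [hr]; simp
    · change Set.range q.pt ⊆ Set.range r.pt
      rw [hr]; simp

variable {k : Type u} [NormedAddCommGroup k] [InnerProductSpace ℂ k] [CompleteSpace k]

/-- `S((π_{j-1}, π_j])`, with `j ∈ {1, …, n + 1}` indexed as `j - 1 : Fin (n + 1)`. -/
def stopIncr (S : QuantumStopTime k) (p : TimePartition) (j : Fin (p.n + 1)) :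
    F k →L[ℂ] F k :=
  S.toFun (Set.Ioc (p.pt j.castSucc) (p.pt j.succ))

/-- The Riemann sum `σ_{S,π}(X) = ∑_j σ_{π_j}(X) S((π_{j-1}, π_j])`. -/
def flowSum (S : QuantumStopTime k) (p : TimePartition) (X : F k →L[ℂ] F k) : F k →L[ℂ] F k :=
  ∑ j : Fin (p.n + 1), ccr (p.pt j.succ) X * stopIncr S p j

/-- The Riemann sum `Γ_{S,π} = ∑_j S((π_{j-1}, π_j]) Γ_{π_j}`. -/
def shiftSum (S : QuantumStopTime k) (p : TimePartition) : F k →L[ℂ] F k :=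
  ∑ j : Fin (p.n + 1), stopIncr S p j * Gam k (p.pt j.succ)

end Riemann

end QStop

end

/-!
Adaptedness makes `S((s, t])` commute with `σ_b(X)` whenever `t ≤ b`. Both Riemann sums are
therefore sums of orthogonal vectors, and the algebraic identities for `σ_{S,π}` can be read
off term by term.

For convergence, passing from a partition to a refinement replaces `σ_t(X)` on an increment
`S((s, t])` by `σ_{t+r}(X) = σ_t(σ_r(X))`. Since `S((s, t])` commutes with the range of `σ_t`,
one has `‖S((s, t]) σ_t(Z) ε(f)‖ ≤ ‖Z ε(θ_t^* f)‖ ‖S((s, t]) ε(f)‖`. With `Z = X - σ_r(X)` the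
first factor is small for small `r`, uniformly for `t` in a bounded interval, because
`r ↦ σ_r(X)` is strongly continuous at `0` and `t ↦ ε(θ_t^* f)` has compact image there.
Squaring and summing, orthogonality bounds the total error by the mesh error times `‖ε(f)‖`;
the part of `S` beyond a large time is small because `S({∞}) = 0`.

In the same way `‖S((s, t]) Γ_t x‖ = ‖S((s, t]) ε(0)‖ ‖x‖`, which gives both the convergence
of `Γ_{S,π}` and, by summing squares, that its limit is isometric. Finally
`σ_t(X) Γ_t = Γ_t X` passes through the sums to the limit.
-/

namespace QStop

universe u

section Hilbert

variable {𝕜 E : Type*} [RCLike 𝕜] [NormedAddCommGroup E] [InnerProductSpace 𝕜 E]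

theorem ext_inner_of_dense_span {s : Set E} (hs : Dense (Submodule.span 𝕜 s : Set E))
    {A B : E →L[𝕜] E} (h : ∀ x ∈ s, ∀ y ∈ s, inner 𝕜 x (A y) = inner 𝕜 x (B y)) : A = B := by
  refine ContinuousLinearMap.ext_on hs fun y hy => ?_
  have key : innerSL 𝕜 (A y) = innerSL 𝕜 (B y) := ContinuousLinearMap.ext_on hs fun x hx => by
    rw [innerSL_apply_apply, innerSL_apply_apply, ← inner_conj_symm, h x hx y hy, inner_conj_symm]
  exact ext_inner_right 𝕜 fun v => congrArg (fun T => T v) key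

theorem tendsto_of_tendsto_inner_of_tendsto_norm {ι : Type*} {l : Filter ι} {u : ι → E} {x : E}
    (hinner : Tendsto (fun i => inner 𝕜 x (u i)) l (𝓝 (inner 𝕜 x x)))
    (hnorm : Tendsto (fun i => ‖u i‖) l (𝓝 ‖x‖)) : Tendsto u l (𝓝 x) := by
  have hsq : Tendsto (fun i => ‖x - u i‖ ^ 2) l (𝓝 0) := by
    have h := (((RCLike.continuous_re.tendsto _).comp hinner).const_mul 2).const_sub (‖x‖ ^ 2)
      |>.add (hnorm.pow 2)
    rw [inner_self_eq_norm_sq] at h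
    refine (h.congr fun i => (norm_sub_sq (𝕜 := 𝕜) x (u i)).symm).trans_eq ?_
    ring_nf
  rw [tendsto_iff_norm_sub_tendsto_zero]
  simpa [norm_sub_rev] using hsq.sqrt

variable [CompleteSpace E]

theorem norm_sq_apply_of_isStarProjection {P : E →L[𝕜] E} (hP : IsStarProjection P) (x : E) :
    ‖P x‖ ^ 2 = RCLike.re (inner 𝕜 x (P x)) := by
  calc ‖P x‖ ^ 2 = RCLike.re (inner 𝕜 x (star P (P x))) := by
        rw [ContinuousLinearMap.star_eq_adjoint, ContinuousLinearMap.adjoint_inner_right,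
          inner_self_eq_norm_sq]
    _ = RCLike.re (inner 𝕜 x (P x)) := by
        rw [hP.isSelfAdjoint.star_eq, ← mul_apply_eq_comp, hP.isIdempotentElem.eq]

theorem norm_apply_le_of_isStarProjection {P : E →L[𝕜] E} (hP : IsStarProjection P) (x : E) :
    ‖P x‖ ≤ ‖x‖ := by
  simpa using P.le_of_opNorm_le (IsStarProjection.norm_le P hP) x

theorem inner_apply_apply_of_mul_eq_zero {P Q : E →L[𝕜] E} (hP : IsStarProjection P)
    (hPQ : P * Q = 0) (x y : E) : inner 𝕜 (P x) (Q y) = 0 := by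
  rw [← ContinuousLinearMap.adjoint_inner_right, ← ContinuousLinearMap.star_eq_adjoint,
    hP.isSelfAdjoint.star_eq, ← mul_apply_eq_comp, hPQ, _root_.zero_apply, inner_zero_right]

theorem norm_sq_sum_of_mul_eq_zero {ι : Type*} (s : Finset ι) {P : ι → E →L[𝕜] E}
    (hP : ∀ i, IsStarProjection (P i)) (hPQ : ∀ i j, i ≠ j → P i * P j = 0) (y : ι → E) :
    ‖∑ i ∈ s, P i (y i)‖ ^ 2 = ∑ i ∈ s, ‖P i (y i)‖ ^ 2 := by
  classical
  induction s using Finset.induction_on with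
  | empty => simp
  | insert a s ha ih =>
    have horth : inner 𝕜 (P a (y a)) (∑ i ∈ s, P i (y i)) = 0 := by
      rw [inner_sum]
      exact Finset.sum_eq_zero fun i hi => inner_apply_apply_of_mul_eq_zero (hP a)
        (hPQ a i (ne_of_mem_of_not_mem hi ha).symm) _ _
    rw [Finset.sum_insert ha, Finset.sum_insert ha, ← ih, @norm_add_sq 𝕜, horth, map_zero,
      mul_zero, add_zero]

end Hilbert

section Idempotent

theorem mul_eq_zero_of_isIdempotentElem_add {R : Type*} [NonUnitalRing R] [IsAddTorsionFree R]
    {p q : R} (hp : IsIdempotentElem p) (hq : IsIdempotentElem q) (hpq : IsIdempotentElem (p + q)) :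
    p * q = 0 :=
  IsIdempotentElem.mul_eq_zero_of_anticommute hp ((IsIdempotentElem.add_iff hp hq).1 hpq)

theorem sum_mul_mul_sum_mul_of_orthogonal {R ι : Type*} [NonUnitalSemiring R] [Fintype ι]
    {p : ι → R} (hp : ∀ i, IsIdempotentElem (p i)) (horth : ∀ i j, i ≠ j → p i * p j = 0)
    (a : ι → R) {b : ι → R} (hb : ∀ i, Commute (p i) (b i)) :
    (∑ i, a i * p i) * ∑ i, b i * p i = ∑ i, a i * b i * p i := by
  classical
  have hterm (i j : ι) : a i * p i * (b j * p j) = if i = j then a i * b i * p i else 0 := by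
    rw [← (hb j).eq, mul_assoc, ← mul_assoc (p i)]
    split_ifs with hij
    · subst hij
      rw [(hp i).eq, (hb i).eq, mul_assoc]
    · rw [horth i j hij, zero_mul, mul_zero]
  simp only [Finset.sum_mul_sum, hterm, Finset.sum_ite_eq, Finset.mem_univ, if_true]

theorem star_sum_mul_of_commute {R ι : Type*} [NonUnitalSemiring R] [StarRing R] {s : Finset ι}
    {p b : ι → R} (hp : ∀ i, IsSelfAdjoint (p i)) (hb : ∀ i, Commute (p i) (b i)) :
    star (∑ i ∈ s, b i * p i) = ∑ i ∈ s, star (b i) * p i := by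
  rw [star_sum]
  refine Finset.sum_congr rfl fun i _ => ?_
  rw [← (hb i).eq, star_mul, (hp i).star_eq]

/-- The sum of `*`-homomorphisms cut down by pairwise orthogonal projections that commute with
their ranges; the orthogonality is what makes the sum multiplicative. -/
def orthogonalSum {𝕜 A B ι : Type*} [CommSemiring 𝕜] [NonUnitalSemiring A] [Module 𝕜 A] [Star A]
    [NonUnitalSemiring B] [Module 𝕜 B] [IsScalarTower 𝕜 B B] [StarRing B] [Fintype ι]
    (φ : ι → A →⋆ₙₐ[𝕜] B) (p : ι → B) (hp : ∀ i, IsStarProjection (p i))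
    (horth : ∀ i j, i ≠ j → p i * p j = 0) (hcomm : ∀ i X, Commute (p i) (φ i X)) :
    A →⋆ₙₐ[𝕜] B where
  toFun X := ∑ i, φ i X * p i
  map_smul' c X := by
    simp only [map_smul, smul_mul_assoc, Finset.smul_sum, MonoidHom.id_apply]
  map_zero' := by simp only [map_zero, zero_mul, Finset.sum_const_zero]
  map_add' X Y := by simp only [map_add, add_mul, Finset.sum_add_distrib]
  map_mul' X Y := by
    simp only [map_mul]
    exact (sum_mul_mul_sum_mul_of_orthogonal (fun i => (hp i).isIdempotentElem) horth _
      fun i => hcomm i Y).symm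
  map_star' X := by
    simp only [map_star]
    exact (star_sum_mul_of_commute (fun i => (hp i).isSelfAdjoint) fun i => hcomm i X).symm

theorem orthogonalSum_apply {𝕜 A B ι : Type*} [CommSemiring 𝕜] [NonUnitalSemiring A] [Module 𝕜 A]
    [Star A] [NonUnitalSemiring B] [Module 𝕜 B] [IsScalarTower 𝕜 B B] [StarRing B] [Fintype ι]
    (φ : ι → A →⋆ₙₐ[𝕜] B) (p : ι → B) (hp : ∀ i, IsStarProjection (p i))
    (horth : ∀ i j, i ≠ j → p i * p j = 0) (hcomm : ∀ i X, Commute (p i) (φ i X)) (X : A) :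
    orthogonalSum φ p hp horth hcomm X = ∑ i, φ i X * p i :=
  rfl

end Idempotent

section OperatorLimits

variable {𝕜 E G ι : Type*} [NontriviallyNormedField 𝕜] [NormedAddCommGroup E] [NormedSpace 𝕜 E]
  [NormedAddCommGroup G] [NormedSpace 𝕜 G] {l : Filter ι} {T : ι → E →L[𝕜] G} {C : ℝ}

theorem tendsto_apply_of_norm_le (hC : ∀ i, ‖T i‖ ≤ C) {y : E} {z : G}
    (hT : Tendsto (fun i => T i y) l (𝓝 z)) {u : ι → E} (hu : Tendsto u l (𝓝 y)) :
    Tendsto (fun i => T i (u i)) l (𝓝 z) := by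
  have hdiff : Tendsto (fun i => T i (u i - y)) l (𝓝 0) := by
    refine squeeze_zero_norm (fun i => (T i).le_of_opNorm_le (hC i) _) ?_
    simpa using (tendsto_iff_norm_sub_tendsto_zero.1 hu).const_mul C
  simpa using hdiff.add hT

theorem tendstoUniformlyOn_of_isCompact (hC : ∀ i, ‖T i‖ ≤ C) (L : E →L[𝕜] G) {K : Set E}
    (hK : IsCompact K) (hT : ∀ x ∈ K, Tendsto (fun i => T i x) l (𝓝 (L x))) :
    TendstoUniformlyOn (fun i x => T i x) L l K := by
  have hequi : Equicontinuous ((↑) ∘ T : ι → E → G) :=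
    ((NormedSpace.equicontinuous_TFAE T).out 5 1 :
      (∃ C, ∀ i, ‖T i‖ ≤ C) ↔ Equicontinuous ((↑) ∘ T)).1 ⟨C, hC⟩
  have h := (EquicontinuousOn.tendsto_uniformOnFun_iff_pi' (𝔖 := {K}) (ℱ := l) (f := L)
    (by rintro _ rfl; exact hK) (by rintro _ rfl; exact hequi.equicontinuousOn _)).2
    (tendsto_pi_nhds.2 fun x => hT x.1 (by simpa using x.2))
  exact UniformOnFun.tendsto_iff_tendstoUniformlyOn.1 h K rfl

theorem exists_tendsto_of_eventually_norm_sub_le {M : Type*} [NormedAddCommGroup M]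
    [CompleteSpace M] [l.NeBot] {u : ι → M} (hu : ∀ ε > 0, ∃ y, ∀ᶠ i in l, ‖u i - y‖ ≤ ε) :
    ∃ y, Tendsto u l (𝓝 y) := by
  refine cauchy_map_iff_exists_tendsto.1 (Metric.cauchy_iff.2 ⟨inferInstance, fun ε hε => ?_⟩)
  obtain ⟨y, hy⟩ := hu (ε / 3) (by positivity)
  refine ⟨_, image_mem_map hy, ?_⟩
  rintro _ ⟨i, hi, rfl⟩ _ ⟨j, hj, rfl⟩
  have hi' : ‖u i - y‖ ≤ ε / 3 := hi
  have hj' : ‖u j - y‖ ≤ ε / 3 := hj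
  rw [← dist_eq_norm] at hi' hj'
  linarith [dist_triangle_right (u i) (u j) y]

theorem exists_continuousLinearMap_tendsto [CompleteSpace G] [l.NeBot] (hC : ∀ i, ‖T i‖ ≤ C)
    {s : Set E} (hs : Dense (Submodule.span 𝕜 s : Set E))
    (hT : ∀ x ∈ s, ∃ y, Tendsto (fun i => T i x) l (𝓝 y)) :
    ∃ L : E →L[𝕜] G, ∀ x, Tendsto (fun i => T i x) l (𝓝 (L x)) := by
  have hspan (x : E) (hx : x ∈ Submodule.span 𝕜 s) : ∃ y, Tendsto (fun i => T i x) l (𝓝 y) := by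
    induction hx using Submodule.span_induction with
    | mem x hx => exact hT x hx
    | zero => exact ⟨0, by simp⟩
    | add x x' _ _ hx hx' =>
      obtain ⟨y, hy⟩ := hx
      obtain ⟨y', hy'⟩ := hx'
      exact ⟨y + y', by simpa using hy.add hy'⟩
    | smul c x _ hx =>
      obtain ⟨y, hy⟩ := hx
      exact ⟨c • y, by simpa using hy.const_smul c⟩
  have hall (x : E) : ∃ y, Tendsto (fun i => T i x) l (𝓝 y) := by
    refine exists_tendsto_of_eventually_norm_sub_le fun ε hε => ?_
    obtain ⟨x', hx'⟩ := hs.exists_dist_lt x (ε := ε / 2 / (|C| + 1)) (by positivity)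
    obtain ⟨y, hy⟩ := hspan x' hx'.1
    refine ⟨y, ((tendsto_iff_norm_sub_tendsto_zero.1 hy).eventually_le_const (half_pos hε)).mono
      fun i hi => ?_⟩
    have hclose : ‖T i (x - x')‖ ≤ ε / 2 := by
      rw [dist_eq_norm, lt_div_iff₀ (by positivity)] at hx'
      refine (T i).le_of_opNorm_le (hC i) _ |>.trans ?_
      nlinarith [le_abs_self C, norm_nonneg (x - x')]
    calc ‖T i x - y‖ = ‖T i (x - x') + (T i x' - y)‖ := by rw [map_sub, sub_add_sub_cancel]
      _ ≤ ε / 2 + ε / 2 := norm_add_le_of_le hclose hi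
      _ = ε := add_halves ε
  choose L hL using hall
  exact ⟨ContinuousLinearMap.ofTendstoOfBoundedRange L T (tendsto_pi_nhds.2 hL)
    (isBounded_iff_forall_norm_le.2 ⟨C, by rintro _ ⟨i, rfl⟩; exact hC i⟩), hL⟩

theorem tendsto_apply_of_dense_span [CompleteSpace G] [l.NeBot] (hC : ∀ i, ‖T i‖ ≤ C)
    {s : Set E} (hs : Dense (Submodule.span 𝕜 s : Set E)) {A : E →L[𝕜] G}
    (hT : ∀ x ∈ s, Tendsto (fun i => T i x) l (𝓝 (A x))) (x : E) :
    Tendsto (fun i => T i x) l (𝓝 (A x)) := by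
  obtain ⟨L, hL⟩ := exists_continuousLinearMap_tendsto hC hs fun x hx => ⟨A x, hT x hx⟩
  obtain rfl : L = A :=
    ContinuousLinearMap.ext_on hs fun x hx => tendsto_nhds_unique (hL x) (hT x hx)
  exact hL x

end OperatorLimits

section StarHomLimits

variable {A E ι : Type*} [CStarAlgebra A] [NormedAddCommGroup E] [InnerProductSpace ℂ E]
  [CompleteSpace E] {l : Filter ι} [l.NeBot]

theorem exists_starAlgHom_tendsto (φ : ι → A →⋆ₙₐ[ℂ] (E →L[ℂ] E))
    (hφ : ∀ a, ∃ L : E →L[ℂ] E, ∀ x, Tendsto (fun i => φ i a x) l (𝓝 (L x)))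
    (hone : ∀ x, Tendsto (fun i => φ i 1 x) l (𝓝 x)) :
    ∃ ψ : A →⋆ₐ[ℂ] (E →L[ℂ] E), ∀ a x, Tendsto (fun i => φ i a x) l (𝓝 (ψ a x)) := by
  choose L hL using hφ
  have hunique {a : A} {x y : E} (h : Tendsto (fun i => φ i a x) l (𝓝 y)) : L a x = y :=
    tendsto_nhds_unique (hL a x) h
  have hsmul (c : ℂ) (a : A) : L (c • a) = c • L a := ContinuousLinearMap.ext fun x =>
    hunique (by simpa using (hL a x).const_smul c)
  have hL_one : L 1 = 1 := ContinuousLinearMap.ext fun x => hunique (hone x)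
  refine ⟨{ toFun := L
            map_one' := hL_one
            map_mul' := fun a b => ?_
            map_zero' := ?_
            map_add' := fun a b => ?_
            commutes' := fun c => ?_
            map_star' := fun a => ?_ }, hL⟩
  · exact ContinuousLinearMap.ext fun x => hunique (by
      simpa using tendsto_apply_of_norm_le (T := fun i => φ i a)
        (fun i => NonUnitalStarAlgHom.norm_apply_le (φ i) a) (hL a (L b x)) (hL b x))
  · exact ContinuousLinearMap.ext fun x => hunique (by simp)
  · exact ContinuousLinearMap.ext fun x => hunique (by simpa using (hL a x).add (hL b x))
  · rw [Algebra.algebraMap_eq_smul_one, hsmul, hL_one, Algebra.algebraMap_eq_smul_one]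
  · refine ContinuousLinearMap.ext fun y => ext_inner_left ℂ fun x => ?_
    rw [ContinuousLinearMap.star_eq_adjoint, ContinuousLinearMap.adjoint_inner_right]
    refine tendsto_nhds_unique ((tendsto_const_nhds (x := x)).inner (hL (star a) y)) ?_
    refine ((hL a x).inner (tendsto_const_nhds (x := y))).congr fun i => ?_
    rw [map_star, ContinuousLinearMap.star_eq_adjoint, ContinuousLinearMap.adjoint_inner_right]

end StarHomLimits

section Tensor

variable {E G : Type*} [NormedAddCommGroup E] [InnerProductSpace ℂ E]
  [NormedAddCommGroup G] [InnerProductSpace ℂ G]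

theorem ampLeft_htmul (A : E →L[ℂ] E) (x : E) (y : G) :
    ampLeft G A (htmul x y) = htmul (A x) y := by
  rw [ampLeft, htmul, ContinuousLinearMap.completion_apply_coe]
  rfl

theorem ampRight_htmul (B : G →L[ℂ] G) (x : E) (y : G) :
    ampRight E B (htmul x y) = htmul x (B y) := by
  rw [ampRight, htmul, ContinuousLinearMap.completion_apply_coe]
  rfl

theorem htmul_add_right (x : E) (y y' : G) : htmul x (y + y') = htmul x y + htmul x y' := by
  simp only [htmul, TensorProduct.tmul_add, UniformSpace.Completion.coe_add]

theorem htmul_smul_right (c : ℂ) (x : E) (y : G) : htmul x (c • y) = c • htmul x y := by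
  rw [htmul, TensorProduct.tmul_smul]
  exact UniformSpace.Completion.coe_smul c (x ⊗ₜ[ℂ] y : E ⊗[ℂ] G)

theorem dense_span_htmul :
    Dense (Submodule.span ℂ (Set.range fun p : E × G => htmul p.1 p.2) : Set (HTensor E G)) := by
  refine UniformSpace.Completion.denseRange_coe.mono ?_
  rintro _ ⟨w, rfl⟩
  induction w using TensorProduct.induction_on with
  | zero => rw [UniformSpace.Completion.coe_zero]; exact zero_mem _
  | tmul x y => exact Submodule.subset_span ⟨(x, y), rfl⟩
  | add w w' hw hw' =>
    rw [UniformSpace.Completion.coe_add]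
    exact add_mem hw hw'

theorem htensor_ext {M : Type*} [NormedAddCommGroup M] [NormedSpace ℂ M]
    {A B : HTensor E G →L[ℂ] M} (h : ∀ x y, A (htmul x y) = B (htmul x y)) : A = B :=
  ContinuousLinearMap.ext_on dense_span_htmul (by rintro _ ⟨p, rfl⟩; exact h p.1 p.2)

theorem commute_ampLeft_ampRight (A : E →L[ℂ] E) (B : G →L[ℂ] G) :
    Commute (ampLeft G A) (ampRight E B) := by
  refine htensor_ext fun x y => ?_
  simp only [mul_apply_eq_comp, ampLeft_htmul, ampRight_htmul]

theorem ampRight_star [CompleteSpace G] (B : G →L[ℂ] G) :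
    ampRight E (star B) = star (ampRight E B) := by
  refine ext_inner_of_dense_span dense_span_htmul ?_
  rintro _ ⟨p, rfl⟩ _ ⟨q, rfl⟩
  simp only [ContinuousLinearMap.star_eq_adjoint, ContinuousLinearMap.adjoint_inner_right,
    ampRight_htmul, inner_htmul]

variable (E) in
/-- The ampliation `B ↦ I ⊗ B` as a unital `*`-homomorphism. -/
noncomputable def ampRightHom [CompleteSpace G] :
    (G →L[ℂ] G) →⋆ₐ[ℂ] (HTensor E G →L[ℂ] HTensor E G) :=
  { AlgHom.ofLinearMap
      { toFun := ampRight E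
        map_add' := fun A B => htensor_ext fun x y => by
          simp only [_root_.add_apply, ampRight_htmul, htmul_add_right]
        map_smul' := fun c A => htensor_ext fun x y => by
          simp only [_root_.smul_apply, RingHom.id_apply, ampRight_htmul, htmul_smul_right] }
      (htensor_ext fun x y => by
        simp only [LinearMap.coe_mk, AddHom.coe_mk, ampRight_htmul, one_apply_eq_self])
      (fun A B => htensor_ext fun x y => by
        simp only [LinearMap.coe_mk, AddHom.coe_mk, mul_apply_eq_comp, ampRight_htmul]) with
    map_star' := ampRight_star }

end Tensor

section Fock

variable {H : Type*} [NormedAddCommGroup H] [InnerProductSpace ℂ H]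

theorem dense_span_ev : Dense (Submodule.span ℂ (Set.range (ev (H := H))) : Set (Fock H)) :=
  Submodule.dense_iff_topologicalClosure_eq_top.2 span_ev_dense

theorem fock_ext {M : Type*} [NormedAddCommGroup M] [NormedSpace ℂ M]
    {A B : Fock H →L[ℂ] M} (h : ∀ f, A (ev f) = B (ev f)) : A = B :=
  ContinuousLinearMap.ext_on dense_span_ev (by rintro _ ⟨f, rfl⟩; exact h f)

theorem norm_ev_sq (f : H) : ‖ev f‖ ^ 2 = Real.exp (‖f‖ ^ 2) := by
  have h := inner_ev f f
  rw [inner_self_eq_norm_sq_to_K, inner_self_eq_norm_sq_to_K] at h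
  refine Complex.ofReal_injective ?_
  push_cast
  exact h

theorem norm_ev_zero : ‖ev (0 : H)‖ = 1 := by
  rw [← pow_eq_one_iff_of_nonneg (norm_nonneg _) two_ne_zero, norm_ev_sq]
  simp

theorem one_le_norm_ev (f : H) : 1 ≤ ‖ev f‖ := by
  rw [← one_le_sq_iff₀ (norm_nonneg _), norm_ev_sq]
  exact Real.one_le_exp (sq_nonneg _)

theorem continuous_ev : Continuous (ev : H → Fock H) := by
  refine continuous_iff_continuousAt.2 fun f => ?_
  refine tendsto_of_tendsto_inner_of_tendsto_norm (𝕜 := ℂ) ?_ ?_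
  · simp only [inner_ev]
    exact Continuous.tendsto (by fun_prop) f
  · have hnorm (g : H) : ‖ev g‖ = √(Real.exp (‖g‖ ^ 2)) := by
      rw [← norm_ev_sq, Real.sqrt_sq (norm_nonneg _)]
    simp only [hnorm]
    exact Continuous.tendsto (by fun_prop) f

end Fock

section Flow

variable {k : Type u} [NormedAddCommGroup k] [InnerProductSpace ℂ k]

theorem split_preOp (t : ℝ≥0) (A : FPre k t →L[ℂ] FPre k t) (x : F k) :
    split k t (preOp t A x) = ampLeft _ A (split k t x) := by
  simp [preOp]

theorem split_postOp (t : ℝ≥0) (B : FPost k t →L[ℂ] FPost k t) (x : F k) :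
    split k t (postOp t B x) = ampRight _ B (split k t x) := by
  simp [postOp]

theorem commute_preOp_postOp (t : ℝ≥0) (A : FPre k t →L[ℂ] FPre k t)
    (B : FPost k t →L[ℂ] FPost k t) : Commute (preOp t A) (postOp t B) := by
  ext x
  apply (split k t).injective
  simp only [mul_apply_eq_comp, split_preOp, split_postOp]
  exact congrArg (fun T => T (split k t x)) (commute_ampLeft_ampRight A B)

/-- The CCR flow at a finite time as a unital `*`-homomorphism. -/
noncomputable def ccrFlowHom (t : ℝ≥0) : (F k →L[ℂ] F k) →⋆ₐ[ℂ] (F k →L[ℂ] F k) :=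
  ((split k t).symm.conjStarAlgEquiv.toStarAlgHom.comp (ampRightHom (FPre k t))).comp
    (GamOnto k t).conjStarAlgEquiv.toStarAlgHom

theorem ccrFlowHom_apply (t : ℝ≥0) (X : F k →L[ℂ] F k) : ccrFlowHom t X = ccrFlow t X := rfl

theorem norm_ccrFlow_le (t : ℝ≥0) (X : F k →L[ℂ] F k) : ‖ccrFlow t X‖ ≤ ‖X‖ :=
  NonUnitalStarAlgHom.norm_apply_le (ccrFlowHom t) X

end Flow

section HalfLine

variable {k : Type u} [NormedAddCommGroup k]

/-- Extension by zero from `L²(ℝ₊; k)` to `L²(ℝ; k)`, where translations act as a group. -/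
noncomputable def extLine (f : L2 k) : Lp k 2 (volume : Measure ℝ) :=
  ((memLp_indicator_iff_restrict measurableSet_Ici).2 (Lp.memLp f)).toLp
    ((Set.Ici (0 : ℝ)).indicator f)

theorem extLine_coeFn (f : L2 k) : extLine f =ᵐ[volume] (Set.Ici (0 : ℝ)).indicator f :=
  MemLp.coeFn_toLp _

theorem translate_extLine_coeFn (a : ℝ) (f : L2 k) :
    (DomAddAct.mk a +ᵥ extLine f : Lp k 2 (volume : Measure ℝ)) =ᵐ[volume]
      fun s => (Set.Ici (0 : ℝ)).indicator f (a + s) :=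
  (DomAddAct.vadd_Lp_ae_eq _ _).trans
    ((measurePreserving_add_left volume a).quasiMeasurePreserving.ae (extLine_coeFn f))

theorem continuous_translate (g : Lp k 2 (volume : Measure ℝ)) :
    Continuous fun a : ℝ => (DomAddAct.mk a +ᵥ g : Lp k 2 (volume : Measure ℝ)) :=
  have : Fact ((2 : ℝ≥0∞) ≠ ∞) := ⟨ENNReal.ofNat_ne_top⟩
  DomAddAct.continuous_mk.vadd continuous_const

end HalfLine

section Shift

variable {k : Type u} [NormedAddCommGroup k] [InnerProductSpace ℂ k]

theorem resL2_coeFn (A : Set ℝ) (f : L2 k) : resL2 A f =ᵐ[lam.restrict A] f :=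
  LpToLpRestrictCLM_coeFn ℂ A f

theorem resL2_Ici_shift (t : ℝ≥0) (f : L2 k) :
    resL2 (Set.Ici (t : ℝ)) (shift k t f) = shiftOnto k t f := by
  refine Lp.ext ?_
  filter_upwards [resL2_coeFn (Set.Ici (t : ℝ)) (shift k t f),
    ae_restrict_of_ae (extZero_coeFn t (shiftOnto k t f)), ae_restrict_mem measurableSet_Ici]
    with s hres hext hs
  exact hres.trans (hext.trans (Set.indicator_of_mem hs _))

theorem resL2_Ico_shift (t : ℝ≥0) (f : L2 k) :
    resL2 (Set.Ico 0 (t : ℝ)) (shift k t f) = 0 := by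
  refine Lp.ext ?_
  filter_upwards [resL2_coeFn (Set.Ico 0 (t : ℝ)) (shift k t f),
    ae_restrict_of_ae (extZero_coeFn t (shiftOnto k t f)), ae_restrict_mem measurableSet_Ico,
    Lp.coeFn_zero k 2 (lam.restrict (Set.Ico 0 (t : ℝ)))] with s hres hext hs hzero
  rw [hzero]
  exact hres.trans (hext.trans (Set.indicator_of_notMem (not_le.2 hs.2) _))

variable (k) in
/-- The left shift `f ↦ f(· + t)` on `L²(ℝ₊; k)`, the adjoint `θ_t^*` of the right shift. -/
noncomputable def leftShift (t : ℝ≥0) : L2 k →L[ℂ] L2 k :=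
  ((shiftOnto k t).symm : L2On k (Set.Ici (t : ℝ)) →L[ℂ] L2 k) ∘L resL2 (Set.Ici (t : ℝ))

theorem shiftOnto_leftShift (t : ℝ≥0) (f : L2 k) :
    shiftOnto k t (leftShift k t f) = resL2 (Set.Ici (t : ℝ)) f :=
  (shiftOnto k t).apply_symm_apply _

theorem inner_shift_left (t : ℝ≥0) (f g : L2 k) :
    inner ℂ (shift k t f) g = inner ℂ f (leftShift k t g) := by
  rw [← inner_split t, resL2_Ico_shift, inner_zero_left, zero_add, resL2_Ici_shift,
    ← shiftOnto_leftShift, LinearIsometryEquiv.inner_map_map]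

theorem inner_resL2_Ico (t : ℝ≥0) (f g : L2 k) :
    inner ℂ (resL2 (Set.Ico 0 (t : ℝ)) f) (resL2 (Set.Ico 0 (t : ℝ)) g) =
      inner ℂ f g - inner ℂ (leftShift k t f) (leftShift k t g) := by
  rw [← inner_split t f g, ← shiftOnto_leftShift, ← shiftOnto_leftShift,
    LinearIsometryEquiv.inner_map_map, add_sub_cancel_right]

variable (k) in
/-- Restriction from `L²(ℝ; k)` to `L²(ℝ₊; k)`. -/
noncomputable def resHalfLine : Lp k 2 (volume : Measure ℝ) →L[ℂ] L2 k :=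
  LpToLpRestrictCLM ℝ k ℂ volume 2 (Set.Ici 0)

theorem resHalfLine_coeFn (g : Lp k 2 (volume : Measure ℝ)) : resHalfLine k g =ᵐ[lam] g :=
  LpToLpRestrictCLM_coeFn ℂ (Set.Ici 0) g

theorem resHalfLine_extLine (f : L2 k) : resHalfLine k (extLine f) = f := by
  refine Lp.ext ?_
  filter_upwards [resHalfLine_coeFn (extLine f), ae_restrict_of_ae (extLine_coeFn f),
    lam_ae_nonneg] with s hres hext hs
  rw [hres, hext, Set.indicator_of_mem (Set.mem_Ici.2 hs)]

theorem extLine_shift (t : ℝ≥0) (f : L2 k) :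
    extLine (shift k t f) = DomAddAct.mk (-(t : ℝ)) +ᵥ extLine f := by
  refine Lp.ext ?_
  filter_upwards [extLine_coeFn (shift k t f), translate_extLine_coeFn (-(t : ℝ)) f,
    (ae_restrict_iff' measurableSet_Ici).1 (shift_coeFn k t f)] with s hext htrans hshift
  rw [hext, htrans, neg_add_eq_sub]
  by_cases hs : 0 ≤ s
  · rw [Set.indicator_of_mem (Set.mem_Ici.2 hs), hshift hs, Set.indicator_apply]
    simp only [Set.mem_Ici, sub_nonneg]
  · rw [Set.indicator_of_notMem (by simpa using hs), Set.indicator_of_notMem]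
    simpa using (not_le.1 hs).trans_le t.coe_nonneg

theorem leftShift_eq_resHalfLine (t : ℝ≥0) (f : L2 k) :
    leftShift k t f = resHalfLine k (DomAddAct.mk (t : ℝ) +ᵥ extLine f) := by
  refine (shiftOnto k t).injective (Lp.ext ?_)
  rw [shiftOnto_leftShift]
  have hres : ∀ᵐ s ∂lam, resHalfLine k (DomAddAct.mk (t : ℝ) +ᵥ extLine f) s = f (t + s) := by
    filter_upwards [resHalfLine_coeFn (DomAddAct.mk (t : ℝ) +ᵥ extLine f),
      ae_restrict_of_ae (translate_extLine_coeFn (t : ℝ) f), lam_ae_nonneg] with s hres htrans hs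
    rw [hres, htrans, Set.indicator_of_mem (Set.mem_Ici.2 (add_nonneg t.coe_nonneg hs))]
  filter_upwards [resL2_coeFn (Set.Ici (t : ℝ)) f,
    Lp.coeFn_compMeasurePreserving (resHalfLine k (DomAddAct.mk (t : ℝ) +ᵥ extLine f))
      (measurePreserving_sub t), (measurePreserving_sub t).quasiMeasurePreserving.ae hres]
    with s hf hcomp hs
  rw [hf]
  exact (hcomp.trans (hs.trans (by rw [add_sub_cancel]))).symm

theorem shift_add (s t : ℝ≥0) (f : L2 k) : shift k (s + t) f = shift k s (shift k t f) := by
  refine Function.LeftInverse.injective resHalfLine_extLine ?_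
  rw [extLine_shift, extLine_shift, extLine_shift, vadd_vadd, NNReal.coe_add, neg_add_rev,
    DomAddAct.mk_add]

theorem leftShift_add (s t : ℝ≥0) (f : L2 k) :
    leftShift k (s + t) f = leftShift k t (leftShift k s f) := by
  refine ext_inner_left ℂ fun g => ?_
  rw [← inner_shift_left, ← inner_shift_left, ← inner_shift_left, shift_add]

theorem leftShift_zero (f : L2 k) : leftShift k 0 f = f := by
  rw [leftShift_eq_resHalfLine, NNReal.coe_zero, DomAddAct.mk_zero, zero_vadd,
    resHalfLine_extLine]

theorem tendsto_shift_zero (f : L2 k) : Tendsto (fun t => shift k t f) (𝓝 0) (𝓝 f) := by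
  have heq (t : ℝ≥0) :
      shift k t f = resHalfLine k (DomAddAct.mk (-(t : ℝ)) +ᵥ extLine f) := by
    rw [← extLine_shift, resHalfLine_extLine]
  have hcont : Continuous fun t => shift k t f := by
    simp only [heq]
    exact (resHalfLine k).continuous.comp ((continuous_translate _).comp (by fun_prop))
  simpa [heq, resHalfLine_extLine] using hcont.tendsto 0

theorem continuous_leftShift (f : L2 k) : Continuous fun t => leftShift k t f := by
  simp only [leftShift_eq_resHalfLine]
  exact (resHalfLine k).continuous.comp ((continuous_translate _).comp NNReal.continuous_coe)

end Shift

section RankOne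

variable {𝕜 E G : Type*} [RCLike 𝕜] [NormedAddCommGroup E] [InnerProductSpace 𝕜 E]
  [NormedAddCommGroup G] [NormedSpace 𝕜 G]

theorem norm_comp_starProjection_singleton_le (Z : E →L[𝕜] G) (u : E) :
    ‖Z ∘L (𝕜 ∙ u).starProjection‖ ≤ ‖Z u‖ / ‖u‖ := by
  refine ContinuousLinearMap.opNorm_le_bound _ (by positivity) fun x => ?_
  rcases eq_or_ne u 0 with rfl | hu
  · simp
  have : 0 < ‖u‖ := norm_pos_iff.2 hu
  calc ‖Z ((𝕜 ∙ u).starProjection x)‖ = ‖inner 𝕜 u x‖ / ‖u‖ ^ 2 * ‖Z u‖ := by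
        rw [Submodule.starProjection_singleton, map_smul, norm_smul, norm_div,
          RCLike.norm_ofReal, abs_of_nonneg (sq_nonneg _)]
    _ ≤ ‖u‖ * ‖x‖ / ‖u‖ ^ 2 * ‖Z u‖ := by gcongr; exact norm_inner_le_norm u x
    _ = ‖Z u‖ / ‖u‖ * ‖x‖ := by field_simp

end RankOne

section FlowContinuity

variable {k : Type u} [NormedAddCommGroup k] [InnerProductSpace ℂ k]

theorem GamOnto_ev (t : ℝ≥0) (f : L2 k) : GamOnto k t (ev f) = ev (shiftOnto k t f) :=
  secondQuantEquiv_ev _ _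

theorem GamOnto_symm_ev_resL2 (t : ℝ≥0) (f : L2 k) :
    (GamOnto k t).symm (ev (resL2 (Set.Ici (t : ℝ)) f)) = ev (leftShift k t f) := by
  rw [LinearIsometryEquiv.symm_apply_eq, GamOnto_ev, shiftOnto_leftShift]

theorem split_ccrFlow_ev (t : ℝ≥0) (X : F k →L[ℂ] F k) (f : L2 k) :
    split k t (ccrFlow t X (ev f)) =
      htmul (ev (resL2 (Set.Ico 0 (t : ℝ)) f)) (GamOnto k t (X (ev (leftShift k t f)))) := by
  rw [ccrFlow, split_postOp, split_ev, ampRight_htmul]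
  simp only [ContinuousLinearMap.comp_apply, LinearIsometryEquiv.coe_coe'', GamOnto_symm_ev_resL2]

theorem inner_ccrFlow_ev (t : ℝ≥0) (X : F k →L[ℂ] F k) (f g : L2 k) :
    inner ℂ (ev f) (ccrFlow t X (ev g)) =
      Complex.exp (inner ℂ f g - inner ℂ (leftShift k t f) (leftShift k t g)) *
        inner ℂ (ev (leftShift k t f)) (X (ev (leftShift k t g))) := by
  rw [← (split k t).inner_map_map, split_ccrFlow_ev, split_ev, inner_htmul, inner_ev,
    inner_resL2_Ico, ← shiftOnto_leftShift, ← GamOnto_ev, LinearIsometryEquiv.inner_map_map]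

theorem ccrFlow_apply_ev_of_apply_ev_leftShift {t : ℝ≥0} {X : F k →L[ℂ] F k} {f : L2 k}
    (hX : X (ev (leftShift k t f)) = ev (leftShift k t f)) : ccrFlow t X (ev f) = ev f := by
  apply (split k t).injective
  rw [split_ccrFlow_ev, hX, GamOnto_ev, shiftOnto_leftShift, split_ev]

theorem ccrFlow_add (s t : ℝ≥0) (X : F k →L[ℂ] F k) :
    ccrFlow (s + t) X = ccrFlow s (ccrFlow t X) := by
  refine ext_inner_of_dense_span dense_span_ev ?_
  rintro _ ⟨f, rfl⟩ _ ⟨g, rfl⟩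
  rw [inner_ccrFlow_ev, inner_ccrFlow_ev, inner_ccrFlow_ev, leftShift_add, leftShift_add,
    ← mul_assoc, ← Complex.exp_add, sub_add_sub_cancel]

theorem norm_ccrFlow_apply_sq (t : ℝ≥0) (X : F k →L[ℂ] F k) (x : F k) :
    ‖ccrFlow t X x‖ ^ 2 = RCLike.re (inner ℂ x (ccrFlow t (star X * X) x)) := by
  rw [← ccrFlowHom_apply t (star X * X), map_mul, map_star, ContinuousLinearMap.star_eq_adjoint,
    mul_apply_eq_comp, ContinuousLinearMap.adjoint_inner_right, inner_self_eq_norm_sq,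
    ccrFlowHom_apply]

theorem tendsto_inner_ev_ccrFlow_ev (X : F k →L[ℂ] F k) (f g : L2 k) :
    Tendsto (fun t => inner ℂ (ev f) (ccrFlow t X (ev g))) (𝓝 0)
      (𝓝 (inner ℂ (ev f) (X (ev g)))) := by
  have hleft (h : L2 k) : Continuous fun t => leftShift k t h := continuous_leftShift h
  have hev (h : L2 k) : Continuous fun t => ev (leftShift k t h) := continuous_ev.comp (hleft h)
  simp only [inner_ccrFlow_ev]
  refine Continuous.tendsto' ?_ 0 _ (by simp only [leftShift_zero, sub_self, Complex.exp_zero,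
    one_mul])
  exact (Complex.continuous_exp.comp (continuous_const.sub ((hleft f).inner (hleft g)))).mul
    ((hev f).inner (X.continuous.comp (hev g)))

theorem tendsto_inner_ccrFlow_ev (X : F k →L[ℂ] F k) (x : F k) (f : L2 k) :
    Tendsto (fun t => inner ℂ x (ccrFlow t X (ev f))) (𝓝 0) (𝓝 (inner ℂ x (X (ev f)))) := by
  have hconj : Tendsto (fun t => innerSL ℂ (ccrFlow t X (ev f)) x) (𝓝 0)
      (𝓝 (innerSL ℂ (X (ev f)) x)) := by
    refine tendsto_apply_of_dense_span (C := ‖X‖ * ‖ev f‖) (fun t => ?_) dense_span_ev ?_ x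
    · rw [innerSL_apply_norm]
      exact (ccrFlow t X).le_of_opNorm_le (norm_ccrFlow_le t X) _
    · rintro _ ⟨g, rfl⟩
      have h := (Complex.continuous_conj.tendsto _).comp (tendsto_inner_ev_ccrFlow_ev X g f)
      simpa only [Function.comp_def, innerSL_apply_apply, inner_conj_symm] using h
  have h := (Complex.continuous_conj.tendsto _).comp hconj
  simpa only [Function.comp_def, innerSL_apply_apply, inner_conj_symm] using h

theorem tendsto_ccrFlow_ev (X : F k →L[ℂ] F k) (f : L2 k) :
    Tendsto (fun t => ccrFlow t X (ev f)) (𝓝 0) (𝓝 (X (ev f))) := by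
  refine tendsto_of_tendsto_inner_of_tendsto_norm (tendsto_inner_ccrFlow_ev X _ f) ?_
  have hnorm := (RCLike.continuous_re.tendsto _).comp
    (tendsto_inner_ev_ccrFlow_ev (star X * X) f f)
  rw [mul_apply_eq_comp, ContinuousLinearMap.star_eq_adjoint,
    ContinuousLinearMap.adjoint_inner_right, inner_self_eq_norm_sq,
    ← ContinuousLinearMap.star_eq_adjoint] at hnorm
  simpa only [Function.comp_def, ← norm_ccrFlow_apply_sq, Real.sqrt_sq (norm_nonneg _)]
    using hnorm.sqrt

theorem eventually_norm_sub_ccrFlow_ev_leftShift_le (X : F k →L[ℂ] F k) (f : L2 k) (T : ℝ≥0)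
    {η : ℝ} (hη : 0 < η) :
    ∀ᶠ r in 𝓝 (0 : ℝ≥0), ∀ t ≤ T, ‖(X - ccrFlow r X) (ev (leftShift k t f))‖ ≤ η := by
  have hcompact : IsCompact ((fun t => ev (leftShift k t f)) '' Set.Icc 0 T) :=
    isCompact_Icc.image (continuous_ev.comp (continuous_leftShift f))
  have hunif := tendstoUniformlyOn_of_isCompact (fun r => norm_ccrFlow_le r X) X hcompact
    (by rintro _ ⟨t, -, rfl⟩; exact tendsto_ccrFlow_ev X _)
  refine (Metric.tendstoUniformlyOn_iff.1 hunif η hη).mono fun r hr t ht => ?_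
  have h := (hr _ ⟨t, ⟨zero_le, ht⟩, rfl⟩).le
  rwa [dist_eq_norm] at h

theorem norm_apply_ccrFlow_ev_le {t : ℝ≥0} {P : F k →L[ℂ] F k}
    (hP : ∀ X, Commute P (ccrFlow t X)) (Z : F k →L[ℂ] F k) (f : L2 k) :
    ‖P (ccrFlow t Z (ev f))‖ ≤ ‖Z (ev (leftShift k t f))‖ * ‖P (ev f)‖ := by
  -- `Z` may be replaced by `Z * Q` with `Q` the projection onto `ℂ u`, as `σ_t(Q)` fixes `ε(f)`;
  -- the operator norm of `Z * Q` only sees the value of `Z` at `u`.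
  set u := ev (leftShift k t f)
  set Q : F k →L[ℂ] F k := (ℂ ∙ u).starProjection
  have hQ : ccrFlow t Q (ev f) = ev f := ccrFlow_apply_ev_of_apply_ev_leftShift
    (Submodule.starProjection_eq_self_iff.2 (Submodule.mem_span_singleton_self u))
  calc ‖P (ccrFlow t Z (ev f))‖ = ‖(P * ccrFlow t (Z * Q)) (ev f)‖ := by
        rw [← ccrFlowHom_apply t (Z * Q), map_mul, ccrFlowHom_apply, ccrFlowHom_apply,
          mul_apply_eq_comp, mul_apply_eq_comp, hQ]
    _ = ‖ccrFlow t (Z * Q) (P (ev f))‖ := by rw [(hP _).eq, mul_apply_eq_comp]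
    _ ≤ ‖Z u‖ / ‖u‖ * ‖P (ev f)‖ := (ccrFlow t (Z * Q)).le_of_opNorm_le
        ((norm_ccrFlow_le t _).trans (norm_comp_starProjection_singleton_le Z u)) _
    _ ≤ ‖Z u‖ * ‖P (ev f)‖ := by
        gcongr
        exact div_le_self (norm_nonneg _) (one_le_norm_ev _)

end FlowContinuity

section ShiftOperators

variable {k : Type u} [NormedAddCommGroup k] [InnerProductSpace ℂ k]

theorem ccr_top (X : F k →L[ℂ] F k) : ccr ∞ X = 1 := if_pos rfl

theorem ccr_of_ne_top {t : ℝ≥0∞} (ht : t ≠ ∞) (X : F k →L[ℂ] F k) :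
    ccr t X = ccrFlow t.toNNReal X := if_neg ht

theorem ccr_coe (t : ℝ≥0) (X : F k →L[ℂ] F k) : ccr t X = ccrFlow t X :=
  ccr_of_ne_top ENNReal.coe_ne_top X

theorem ccr_one (t : ℝ≥0∞) : ccr t (1 : F k →L[ℂ] F k) = 1 := by
  induction t with
  | top => exact ccr_top 1
  | coe t => rw [ccr_coe, ← ccrFlowHom_apply, map_one]

theorem ccr_mul (t : ℝ≥0∞) (X Y : F k →L[ℂ] F k) : ccr t (X * Y) = ccr t X * ccr t Y := by
  induction t with
  | top => simp only [ccr_top, one_mul]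
  | coe t => simp only [ccr_coe, ← ccrFlowHom_apply, map_mul]

theorem ccr_star (t : ℝ≥0∞) (X : F k →L[ℂ] F k) : ccr t (star X) = star (ccr t X) := by
  induction t with
  | top => simp only [ccr_top, star_one]
  | coe t => simp only [ccr_coe, ← ccrFlowHom_apply, map_star]

theorem norm_ccr_le (t : ℝ≥0∞) (X : F k →L[ℂ] F k) : ‖ccr t X‖ ≤ ‖X‖ + 1 := by
  induction t with
  | top =>
    rw [ccr_top]
    exact ContinuousLinearMap.norm_id_le.trans (le_add_of_nonneg_left (norm_nonneg X))
  | coe t =>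
    rw [ccr_coe]
    exact (norm_ccrFlow_le t X).trans (le_add_of_nonneg_right zero_le_one)

theorem Gam_top : Gam k ∞ = vacProj k := if_pos rfl

theorem Gam_coe (t : ℝ≥0) : Gam k t = (secondQuant (shift k t)).toContinuousLinearMap :=
  if_neg ENNReal.coe_ne_top

theorem Gam_coe_ev (t : ℝ≥0) (f : L2 k) : Gam k t (ev f) = ev (shift k t f) := by
  rw [Gam_coe]
  exact secondQuant_ev _ _

theorem norm_Gam_coe (t : ℝ≥0) (x : F k) : ‖Gam k t x‖ = ‖x‖ := by
  rw [Gam_coe]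
  exact (secondQuant (shift k t)).norm_map x

theorem Gam_coe_ev_zero (t : ℝ≥0) : Gam k t (ev 0) = ev 0 := by
  rw [Gam_coe_ev, map_zero]

theorem vacProj_ev (f : L2 k) : vacProj k (ev f) = ev 0 := by
  rw [vacProj]
  simp [Submodule.starProjection_singleton, inner_ev, norm_ev_zero]

theorem norm_Gam_le (t : ℝ≥0∞) (x : F k) : ‖Gam k t x‖ ≤ ‖x‖ := by
  induction t with
  | top => exact Gam_top (k := k) ▸ Submodule.norm_starProjection_apply_le _ x
  | coe t => exact (norm_Gam_coe t x).le

theorem Gam_coe_add (s : ℝ≥0) (t : ℝ≥0∞) : Gam k (s + t) = Gam k s * Gam k t := by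
  refine fock_ext fun f => ?_
  induction t with
  | top => rw [add_top, Gam_top, mul_apply_eq_comp, vacProj_ev, Gam_coe_ev_zero]
  | coe t =>
    rw [← ENNReal.coe_add, mul_apply_eq_comp, Gam_coe_ev, Gam_coe_ev, Gam_coe_ev, shift_add]

theorem tendsto_Gam_zero (x : F k) : Tendsto (fun t : ℝ≥0 => Gam k t x) (𝓝 0) (𝓝 x) := by
  refine tendsto_apply_of_dense_span (T := fun t : ℝ≥0 => Gam k t) (A := 1) (C := 1)
    (fun t => ?_) dense_span_ev ?_ x
  · exact ContinuousLinearMap.opNorm_le_bound _ zero_le_one fun x => by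
      rw [norm_Gam_coe, one_mul]
  · rintro _ ⟨f, rfl⟩
    simp only [Gam_coe_ev]
    exact (continuous_ev.tendsto f).comp (tendsto_shift_zero f)

theorem inner_ev_Gam_coe (t : ℝ≥0) (f : L2 k) (x : F k) :
    inner ℂ (ev f) (Gam k t x) = inner ℂ (ev (leftShift k t f)) x := by
  have h : innerSL ℂ (ev f) ∘L Gam k t = innerSL ℂ (ev (leftShift k t f)) := by
    refine fock_ext fun g => ?_
    rw [ContinuousLinearMap.comp_apply, innerSL_apply_apply, innerSL_apply_apply, Gam_coe_ev,
      inner_ev, inner_ev, ← inner_conj_symm, inner_shift_left, inner_conj_symm]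
  exact congrArg (fun T => T x) h

theorem leftShift_shift (t : ℝ≥0) (f : L2 k) : leftShift k t (shift k t f) = f := by
  apply (shiftOnto k t).injective
  rw [shiftOnto_leftShift, resL2_Ici_shift]

theorem ccrFlow_mul_Gam (t : ℝ≥0) (X : F k →L[ℂ] F k) :
    ccrFlow t X * Gam k t = Gam k t * X := by
  refine ext_inner_of_dense_span dense_span_ev ?_
  rintro _ ⟨f, rfl⟩ _ ⟨g, rfl⟩
  rw [mul_apply_eq_comp, mul_apply_eq_comp, Gam_coe_ev, inner_ccrFlow_ev, inner_ev_Gam_coe,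
    leftShift_shift, ← inner_conj_symm f, inner_shift_left, inner_conj_symm, sub_self,
    Complex.exp_zero, one_mul]

theorem ccr_mul_Gam {t : ℝ≥0∞} (ht : t ≠ ∞) (X : F k →L[ℂ] F k) :
    ccr t X * Gam k t = Gam k t * X := by
  lift t to ℝ≥0 using ht
  rw [ccr_coe, ccrFlow_mul_Gam]

theorem norm_mul_norm_apply_Gam_le {t : ℝ≥0} {P : F k →L[ℂ] F k}
    (hP : ∀ X, Commute P (ccrFlow t X)) (x y : F k) :
    ‖y‖ * ‖P (Gam k t x)‖ ≤ ‖x‖ * ‖P (Gam k t y)‖ := by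
  -- `P Γ_t R y = σ_t(R) P Γ_t y` for every `R`; the rank-one operator `R = ⟪y, ·⟫ x` sends `y`
  -- to a multiple of `x`.
  set R : F k →L[ℂ] F k := InnerProductSpace.rankOne ℂ x y
  have hR : P (Gam k t (R y)) = ccrFlow t R (P (Gam k t y)) := by
    rw [← mul_apply_eq_comp (Gam k t), ← ccrFlow_mul_Gam, mul_apply_eq_comp,
      ← mul_apply_eq_comp, (hP R).eq, mul_apply_eq_comp]
  rcases eq_or_ne y 0 with rfl | hy
  · simp
  refine le_of_mul_le_mul_left ?_ (norm_pos_iff.2 hy)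
  calc ‖y‖ * (‖y‖ * ‖P (Gam k t x)‖) = ‖P (Gam k t (R y))‖ := by
        rw [InnerProductSpace.rankOne_apply, inner_self_eq_norm_sq_to_K, map_smul, map_smul,
          norm_smul, norm_pow, RCLike.norm_ofReal, abs_norm, sq, mul_assoc]
    _ ≤ ‖R‖ * ‖P (Gam k t y)‖ := by
        rw [hR]
        exact (ccrFlow t R).le_of_opNorm_le (norm_ccrFlow_le t R) _
    _ = ‖y‖ * (‖x‖ * ‖P (Gam k t y)‖) := by
        rw [InnerProductSpace.norm_rankOne, mul_comm ‖x‖, mul_assoc]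

theorem norm_apply_Gam {t : ℝ≥0} {P : F k →L[ℂ] F k} (hP : ∀ X, Commute P (ccrFlow t X))
    (x : F k) : ‖P (Gam k t x)‖ = ‖P (ev 0)‖ * ‖x‖ := by
  have hle := norm_mul_norm_apply_Gam_le hP x (ev 0)
  have hge := norm_mul_norm_apply_Gam_le hP (ev 0) x
  rw [norm_ev_zero, one_mul, Gam_coe_ev_zero] at hle hge
  linarith

end ShiftOperators

section StopTime

variable {k : Type u} [NormedAddCommGroup k] [InnerProductSpace ℂ k]

theorem commute_preOp_ccrFlow {s t : ℝ≥0} (hst : s ≤ t) (A : FPre k s →L[ℂ] FPre k s)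
    (X : F k →L[ℂ] F k) : Commute (preOp s A) (ccrFlow t X) := by
  obtain ⟨r, rfl⟩ := exists_add_of_le hst
  rw [ccrFlow_add]
  exact commute_preOp_postOp s A _

namespace QuantumStopTime

variable (S : QuantumStopTime k)

theorem apply_biUnion {ι : Type*} (s : Finset ι) {A : ι → Set ℝ≥0∞}
    (hd : (s : Set ι).PairwiseDisjoint A) (hA : ∀ i ∈ s, MeasurableSet (A i)) :
    S.toFun (⋃ i ∈ s, A i) = ∑ i ∈ s, S.toFun (A i) := by
  ext y
  refine ext_inner_left ℂ fun x => ?_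
  obtain ⟨μ, hμ⟩ := S.isMeasure x y
  rw [← hμ _ (s.measurableSet_biUnion hA), VectorMeasure.of_biUnion_finset hd hA,
    _root_.sum_apply, inner_sum]
  exact Finset.sum_congr rfl fun i hi => hμ _ (hA i hi)

theorem apply_union {A B : Set ℝ≥0∞} (hAB : Disjoint A B) (hA : MeasurableSet A)
    (hB : MeasurableSet B) : S.toFun (A ∪ B) = S.toFun A + S.toFun B := by
  ext y
  refine ext_inner_left ℂ fun x => ?_
  obtain ⟨μ, hμ⟩ := S.isMeasure x y
  rw [← hμ _ (hA.union hB), VectorMeasure.of_union hAB hA hB, hμ _ hA, hμ _ hB,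
    _root_.add_apply, inner_add_right]

theorem apply_mul_apply_of_disjoint {A B : Set ℝ≥0∞} (hAB : Disjoint A B) (hA : MeasurableSet A)
    (hB : MeasurableSet B) : S.toFun A * S.toFun B = 0 :=
  have : IsAddTorsionFree (F k →L[ℂ] F k) := .of_isTorsionFree ℂ _
  mul_eq_zero_of_isIdempotentElem_add (S.isProj A hA).isIdempotentElem
    (S.isProj B hB).isIdempotentElem
    (S.apply_union hAB hA hB ▸ (S.isProj _ (hA.union hB)).isIdempotentElem)

theorem apply_mul_apply_of_subset {A B : Set ℝ≥0∞} (hAB : A ⊆ B) (hA : MeasurableSet A)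
    (hB : MeasurableSet B) : S.toFun A * S.toFun B = S.toFun A := by
  rw [← Set.union_sdiff_cancel hAB, S.apply_union Set.disjoint_sdiff_right hA (hB.diff hA),
    mul_add, S.apply_mul_apply_of_disjoint Set.disjoint_sdiff_right hA (hB.diff hA), add_zero,
    (S.isProj A hA).isIdempotentElem.eq]

theorem tendsto_apply_Ioi_natCast (hT : S.toFun {∞} = 0) (x : F k) :
    Tendsto (fun n : ℕ => S.toFun (Set.Ioi (n : ℝ≥0∞)) x) atTop (𝓝 0) := by
  obtain ⟨μ, hμ⟩ := S.isMeasure x x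
  have hμ_lim := μ.tendsto_vectorMeasure_iInter_atTop_nat
    (s := fun n : ℕ => Set.Ioi (n : ℝ≥0∞))
    (fun m n hmn => Set.Ioi_subset_Ioi (Nat.cast_le.2 hmn)) (fun n => measurableSet_Ioi)
  rw [ENNReal.iInter_Ioi_coe_nat, hμ _ (measurableSet_singleton _), hT, _root_.zero_apply,
    inner_zero_right] at hμ_lim
  have hsq : Tendsto (fun n : ℕ => ‖S.toFun (Set.Ioi (n : ℝ≥0∞)) x‖ ^ 2) atTop (𝓝 0) := by
    refine ((RCLike.continuous_re.tendsto' (0 : ℂ) 0 (map_zero _)).comp hμ_lim).congr fun n => ?_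
    rw [Function.comp_apply, hμ _ measurableSet_Ioi,
      norm_sq_apply_of_isStarProjection (S.isProj _ measurableSet_Ioi)]
  rw [tendsto_zero_iff_norm_tendsto_zero]
  simpa using hsq.sqrt

theorem apply_Ioc {s t : ℝ≥0∞} (hst : s ≤ t) :
    S.toFun (Set.Ioc s t) = S.toFun (Set.Icc 0 t) - S.toFun (Set.Icc 0 s) := by
  have hdisj : Disjoint (Set.Icc 0 s) (Set.Ioc s t) :=
    Set.disjoint_left.2 fun r hr hr' => hr'.1.not_ge hr.2
  rw [← Set.Icc_union_Ioc_eq_Icc zero_le hst,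
    S.apply_union hdisj measurableSet_Icc measurableSet_Ioc, add_sub_cancel_left]

theorem apply_Ioc_zero_top (h0 : S.toFun {0} = 0) : S.toFun (Set.Ioc 0 ∞) = 1 := by
  have huniv : Set.Icc (0 : ℝ≥0∞) ∞ = Set.univ := Set.Icc_bot_top
  rw [S.apply_Ioc zero_le, Set.Icc_self, h0, sub_zero, huniv, S.map_univ]

theorem commute_Icc_ccrFlow {s t : ℝ≥0} (hst : s ≤ t) (X : F k →L[ℂ] F k) :
    Commute (S.toFun (Set.Icc 0 s)) (ccrFlow t X) := by
  rcases eq_zero_or_pos s with rfl | hs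
  · obtain ⟨c, hc⟩ := S.adapted_zero
    rw [ENNReal.coe_zero, Set.Icc_self, hc]
    exact (Commute.one_left _).smul_left c
  · obtain ⟨A, hA⟩ := S.adapted s hs
    rw [hA]
    exact commute_preOp_ccrFlow hst A X

theorem commute_Ioc_ccrFlow {s t b : ℝ≥0} (hst : s ≤ t) (htb : t ≤ b) (X : F k →L[ℂ] F k) :
    Commute (S.toFun (Set.Ioc s t)) (ccrFlow b X) := by
  rw [S.apply_Ioc (ENNReal.coe_le_coe.2 hst)]
  exact (S.commute_Icc_ccrFlow htb X).sub_left (S.commute_Icc_ccrFlow (hst.trans htb) X)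

theorem commute_Ioc_ccr {s t b : ℝ≥0∞} (hst : s ≤ t) (htb : t ≤ b) (X : F k →L[ℂ] F k) :
    Commute (S.toFun (Set.Ioc s t)) (ccr b X) := by
  rcases eq_or_ne b ∞ with rfl | hb
  · rw [ccr_top]
    exact Commute.one_right _
  · lift b to ℝ≥0 using hb
    lift t to ℝ≥0 using ne_top_of_le_ne_top ENNReal.coe_ne_top htb
    lift s to ℝ≥0 using ne_top_of_le_ne_top ENNReal.coe_ne_top hst
    rw [ccr_coe]
    exact S.commute_Ioc_ccrFlow (ENNReal.coe_le_coe.1 hst) (ENNReal.coe_le_coe.1 htb) X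

end QuantumStopTime

end StopTime

namespace TimePartition

variable (p : TimePartition)

/-- The `j`-th interval `(π_j, π_{j+1}]` of a partition, with `j` counted from `0`. -/
def interval (j : Fin (p.n + 1)) : Set ℝ≥0∞ := Set.Ioc (p.pt j.castSucc) (p.pt j.succ)

theorem measurableSet_interval (j : Fin (p.n + 1)) : MeasurableSet (p.interval j) :=
  measurableSet_Ioc

theorem pt_castSucc_lt_pt_succ (j : Fin (p.n + 1)) : p.pt j.castSucc < p.pt j.succ :=
  p.strictMono Fin.castSucc_lt_succ

theorem pt_castSucc_ne_top (j : Fin (p.n + 1)) : p.pt j.castSucc ≠ ∞ :=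
  (p.pt_castSucc_lt_pt_succ j).ne_top

theorem pt_castSucc_succ_ne_top (j : Fin p.n) : p.pt j.castSucc.succ ≠ ∞ := by
  rw [Fin.succ_castSucc]
  exact p.pt_castSucc_ne_top _

theorem pt_succ_le {r : ℝ≥0∞} (hr : r ∈ Set.range p.pt) {j : Fin (p.n + 1)}
    (hj : p.pt j.castSucc < r) : p.pt j.succ ≤ r := by
  obtain ⟨m, rfl⟩ := hr
  exact p.strictMono.monotone (Fin.castSucc_lt_iff_succ_le.1 (p.strictMono.lt_iff_lt.1 hj))

theorem le_pt_last_castSucc {T : ℝ≥0} (hT : (T : ℝ≥0∞) ∈ Set.range p.pt) :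
    (T : ℝ≥0∞) ≤ p.pt (Fin.last p.n).castSucc := by
  by_contra! hlt
  have htop := p.pt_succ_le hT hlt
  rw [Fin.succ_last, p.pt_last] at htop
  exact htop.not_gt ENNReal.coe_lt_top

theorem disjoint_interval {i j : Fin (p.n + 1)} (hij : i ≠ j) :
    Disjoint (p.interval i) (p.interval j) := by
  wlog hlt : i < j generalizing i j
  · exact (this hij.symm (hij.lt_or_gt.resolve_left hlt)).symm
  exact Set.disjoint_left.2 fun t hi hj =>
    hj.1.not_ge (hi.2.trans (p.strictMono.monotone (Fin.succ_le_castSucc_iff.2 hlt)))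

theorem exists_mem_interval {t : ℝ≥0∞} (ht : 0 < t) : ∃ j, t ∈ p.interval j := by
  obtain ⟨m, hm, hmin⟩ := wellFounded_lt.has_min {m | t ≤ p.pt m}
    ⟨Fin.last _, le_top.trans_eq p.pt_last.symm⟩
  have hm0 : m ≠ 0 := by
    rintro rfl
    exact (p.pt_zero ▸ hm : t ≤ 0).not_gt ht
  obtain ⟨j, rfl⟩ := Fin.exists_succ_eq.2 hm0
  exact ⟨j, not_le.1 fun hj => hmin _ hj Fin.castSucc_lt_succ, hm⟩

theorem iUnion_interval : ⋃ j, p.interval j = Set.Ioc 0 ∞ := by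
  ext t
  rw [Set.mem_iUnion]
  exact ⟨fun ⟨j, hj⟩ => ⟨zero_le.trans_lt hj.1, le_top⟩, fun ht => p.exists_mem_interval ht.1⟩

variable {p} in
theorem exists_interval_subset {q : TimePartition} (hpq : p ≤ q) (j : Fin (q.n + 1)) :
    ∃ i, q.interval j ⊆ p.interval i := by
  obtain ⟨i, hlt, hle⟩ := p.exists_mem_interval (zero_le.trans_lt (q.pt_castSucc_lt_pt_succ j))
  refine ⟨i, Set.Ioc_subset_Ioc (not_lt.1 fun hij => hlt.not_ge ?_) hle⟩
  exact q.pt_succ_le (hpq ⟨_, rfl⟩) hij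

theorem exists_range_pt_eq_grid (d : ℝ≥0) (N : ℕ) :
    ∃ p : TimePartition,
      Set.range p.pt = insert ∞ ((fun m : ℕ => ((m * d : ℝ≥0) : ℝ≥0∞)) '' Set.Iic N) := by
  classical
  obtain ⟨p, hp⟩ := exists_of_finset
    (insert ∞ ((Finset.Iic N).image fun m : ℕ => ((m * d : ℝ≥0) : ℝ≥0∞)))
    (Finset.mem_insert_of_mem (Finset.mem_image.2 ⟨0, by simp, by simp⟩))
    (Finset.mem_insert_self _ _)
  exact ⟨p, by rw [hp, Finset.coe_insert, Finset.coe_image, Finset.coe_Iic]⟩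

theorem pt_succ_le_add_of_range_pt_eq_grid {p : TimePartition} {d : ℝ≥0} {N : ℕ}
    (hp : Set.range p.pt = insert ∞ ((fun m : ℕ => ((m * d : ℝ≥0) : ℝ≥0∞)) '' Set.Iic N))
    {i : Fin (p.n + 1)} (hi : p.pt i.castSucc < (N * d : ℝ≥0)) :
    p.pt i.succ ≤ p.pt i.castSucc + d := by
  obtain ⟨m, -, hm⟩ : p.pt i.castSucc ∈ (fun m : ℕ => ((m * d : ℝ≥0) : ℝ≥0∞)) '' Set.Iic N :=
    (hp ▸ Set.mem_range_self i.castSucc).resolve_left (p.pt_castSucc_ne_top i)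
  rw [← hm, ENNReal.coe_lt_coe] at hi
  have hmN : m < N := Nat.cast_lt.1 (lt_of_mul_lt_mul_right hi zero_le)
  have hd : 0 < d := pos_of_mul_pos_right (zero_le.trans_lt hi) zero_le
  have hnext : ((m * d : ℝ≥0) : ℝ≥0∞) + d = ((m + 1 : ℕ) * d : ℝ≥0) := by
    push_cast
    rw [add_mul, one_mul]
  rw [← hm, hnext]
  refine p.pt_succ_le (hp ▸ Set.mem_insert_of_mem _ ⟨m + 1, hmN, rfl⟩) ?_
  rw [← hm, ← hnext]
  exact ENNReal.lt_add_right ENNReal.coe_ne_top (ENNReal.coe_ne_zero.2 hd.ne')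

theorem exists_mesh_lt (T : ℝ≥0) {δ : ℝ≥0} (hδ : 0 < δ) :
    ∃ p : TimePartition, (T : ℝ≥0∞) ∈ Set.range p.pt ∧
      ∀ i : Fin (p.n + 1), p.pt i.castSucc < T → p.pt i.succ < p.pt i.castSucc + δ := by
  obtain ⟨N, hN⟩ := exists_nat_gt (T / δ)
  have hN0 : (0 : ℝ≥0) < N := zero_le.trans_lt hN
  have hdδ : T / N < δ := by
    rw [div_lt_iff₀ hδ] at hN
    rwa [div_lt_iff₀ hN0, mul_comm]
  have hNd : N * (T / N) = T := mul_div_cancel₀ _ hN0.ne'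
  obtain ⟨p, hp⟩ := exists_range_pt_eq_grid (T / N) N
  refine ⟨p, hp ▸ Set.mem_insert_of_mem _ ⟨N, Set.mem_Iic.2 le_rfl, by simp only [hNd]⟩,
    fun i hi => ?_⟩
  refine (pt_succ_le_add_of_range_pt_eq_grid hp (hNd.symm ▸ hi)).trans_lt ?_
  exact ENNReal.add_lt_add_left (p.pt_castSucc_ne_top i) (ENNReal.coe_lt_coe.2 hdδ)

end TimePartition

section Increments

variable {k : Type u} [NormedAddCommGroup k] [InnerProductSpace ℂ k] (S : QuantumStopTime k)

theorem isStarProjection_stopIncr (p : TimePartition) (j : Fin (p.n + 1)) :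
    IsStarProjection (stopIncr S p j) :=
  S.isProj _ (p.measurableSet_interval j)

theorem stopIncr_mul_stopIncr (p : TimePartition) {i j : Fin (p.n + 1)} (hij : i ≠ j) :
    stopIncr S p i * stopIncr S p j = 0 :=
  S.apply_mul_apply_of_disjoint (p.disjoint_interval hij) (p.measurableSet_interval i)
    (p.measurableSet_interval j)

theorem commute_stopIncr_ccr (p : TimePartition) (j : Fin (p.n + 1)) (X : F k →L[ℂ] F k) :
    Commute (stopIncr S p j) (ccr (p.pt j.succ) X) :=
  S.commute_Ioc_ccr (p.pt_castSucc_lt_pt_succ j).le le_rfl X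

theorem sum_stopIncr (h0 : S.toFun {0} = 0) (p : TimePartition) :
    ∑ j, stopIncr S p j = 1 := by
  have hunion := S.apply_biUnion Finset.univ (A := p.interval)
    (fun _ _ _ _ hij => p.disjoint_interval hij) fun j _ => p.measurableSet_interval j
  simp only [Finset.mem_univ, Set.iUnion_true, p.iUnion_interval, S.apply_Ioc_zero_top h0]
    at hunion
  exact hunion.symm

theorem sum_norm_sq_stopIncr_apply (h0 : S.toFun {0} = 0) (p : TimePartition) (x : F k) :
    ∑ j, ‖stopIncr S p j x‖ ^ 2 = ‖x‖ ^ 2 := by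
  rw [← norm_sq_sum_of_mul_eq_zero Finset.univ (isStarProjection_stopIncr S p)
    (fun _ _ => stopIncr_mul_stopIncr S p) fun _ => x, ← _root_.sum_apply, sum_stopIncr S h0,
    one_apply_eq_self]

theorem norm_sum_stopIncr_apply_le (h0 : S.toFun {0} = 0) (p : TimePartition)
    {y : Fin (p.n + 1) → F k} {w u : F k} {η C : ℝ} (hη : 0 ≤ η) (hC : 0 ≤ C)
    (hy : ∀ j, ‖stopIncr S p j (y j)‖ ≤ η * ‖stopIncr S p j w‖ ∨
      ‖stopIncr S p j (y j)‖ ≤ C * ‖stopIncr S p j u‖) :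
    ‖∑ j, stopIncr S p j (y j)‖ ≤ η * ‖w‖ + C * ‖u‖ := by
  have hterm (j : Fin (p.n + 1)) : ‖stopIncr S p j (y j)‖ ^ 2 ≤
      η ^ 2 * ‖stopIncr S p j w‖ ^ 2 + C ^ 2 * ‖stopIncr S p j u‖ ^ 2 := by
    rw [← mul_pow, ← mul_pow]
    rcases hy j with h | h
    · exact (pow_le_pow_left₀ (norm_nonneg _) h 2).trans (le_add_of_nonneg_right (sq_nonneg _))
    · exact (pow_le_pow_left₀ (norm_nonneg _) h 2).trans (le_add_of_nonneg_left (sq_nonneg _))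
  refine le_of_sq_le_sq ?_ (by positivity)
  calc ‖∑ j, stopIncr S p j (y j)‖ ^ 2 = ∑ j, ‖stopIncr S p j (y j)‖ ^ 2 :=
        norm_sq_sum_of_mul_eq_zero _ (isStarProjection_stopIncr S p)
          (fun _ _ => stopIncr_mul_stopIncr S p) y
    _ ≤ ∑ j, (η ^ 2 * ‖stopIncr S p j w‖ ^ 2 + C ^ 2 * ‖stopIncr S p j u‖ ^ 2) :=
        Finset.sum_le_sum fun j _ => hterm j
    _ = (η * ‖w‖) ^ 2 + (C * ‖u‖) ^ 2 := by
        rw [Finset.sum_add_distrib, ← Finset.mul_sum, ← Finset.mul_sum,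
          sum_norm_sq_stopIncr_apply S h0, sum_norm_sq_stopIncr_apply S h0, mul_pow, mul_pow]
    _ ≤ (η * ‖w‖ + C * ‖u‖) ^ 2 := by
        rw [add_sq]
        linarith [show 0 ≤ 2 * (η * ‖w‖) * (C * ‖u‖) by positivity]

theorem stopIncr_eq_sum {p q : TimePartition} {i : Fin (q.n + 1) → Fin (p.n + 1)}
    (hi : ∀ j, q.interval j ⊆ p.interval (i j)) (a : Fin (p.n + 1)) :
    stopIncr S p a = ∑ j with i j = a, stopIncr S q j := by
  refine Eq.trans ?_ (S.apply_biUnion (Finset.univ.filter fun j => i j = a) (A := q.interval)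
    (fun _ _ _ _ hij => q.disjoint_interval hij) fun j _ => q.measurableSet_interval j)
  refine congrArg S.toFun (Set.Subset.antisymm (fun t ht => ?_) ?_)
  · obtain ⟨j, hj⟩ := q.exists_mem_interval (zero_le.trans_lt ht.1)
    refine Set.mem_biUnion (Finset.mem_filter.2 ⟨Finset.mem_univ j, ?_⟩) hj
    by_contra hne
    exact Set.disjoint_left.1 (p.disjoint_interval hne) (hi j hj) ht
  · exact Set.iUnion₂_subset fun j hj => (Finset.mem_filter.1 hj).2 ▸ hi j

theorem stopIncr_mul_apply_Ioi {T : ℝ≥0∞} {p : TimePartition} {j : Fin (p.n + 1)}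
    (hT : T ≤ p.pt j.castSucc) : stopIncr S p j * S.toFun (Set.Ioi T) = stopIncr S p j :=
  S.apply_mul_apply_of_subset (fun _ ht => hT.trans_lt ht.1) (p.measurableSet_interval j)
    measurableSet_Ioi

theorem tendsto_stopIncr_last (hT : S.toFun {∞} = 0) (x : F k) :
    Tendsto (fun p : TimePartition => stopIncr S p (Fin.last p.n) x) atTop (𝓝 0) := by
  rw [Metric.tendsto_nhds]
  intro ε hε
  obtain ⟨n, hn⟩ := (Metric.tendsto_nhds.1 (S.tendsto_apply_Ioi_natCast hT x) ε hε).exists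
  obtain ⟨p, hp, -⟩ := TimePartition.exists_mesh_lt n one_pos
  filter_upwards [eventually_ge_atTop p] with q hpq
  rw [dist_zero_right] at hn ⊢
  rw [← stopIncr_mul_apply_Ioi S (q.le_pt_last_castSucc (hpq hp)), mul_apply_eq_comp]
  exact (norm_apply_le_of_isStarProjection (isStarProjection_stopIncr S q _) _).trans_lt hn

end Increments

section RiemannSums

variable {k : Type u} [NormedAddCommGroup k] [InnerProductSpace ℂ k] (S : QuantumStopTime k)

/-- The Riemann sum `∑_j S((π_{j-1}, π_j]) v(π_j)` of a vector-valued function `v` over a quantum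
stop time. It evaluates `v` at right endpoints, like `flowSum` and `shiftSum`. -/
noncomputable def riemannSum (v : ℝ≥0∞ → F k) (p : TimePartition) : F k :=
  ∑ j, stopIncr S p j (v (p.pt j.succ))

theorem riemannSum_eq_sum_refinement (v : ℝ≥0∞ → F k) {p q : TimePartition}
    {i : Fin (q.n + 1) → Fin (p.n + 1)} (hi : ∀ j, q.interval j ⊆ p.interval (i j)) :
    riemannSum S v p = ∑ j, stopIncr S q j (v (p.pt (i j).succ)) := by
  rw [riemannSum, ← Finset.sum_fiberwise Finset.univ i]
  refine Finset.sum_congr rfl fun a _ => ?_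
  rw [stopIncr_eq_sum S hi a, _root_.sum_apply]
  exact Finset.sum_congr rfl fun j hj => by rw [(Finset.mem_filter.1 hj).2]

variable {v : ℝ≥0∞ → F k} {w : F k} {C : ℝ}

theorem exists_forall_norm_stopIncr_sub_le (T : ℝ≥0) {η : ℝ}
    (hmesh : ∀ᶠ r : ℝ≥0 in 𝓝 0, ∀ s t : ℝ≥0, s ≤ t → t ≤ T →
      ‖S.toFun (Set.Ioc s t) (v t - v (t + r))‖ ≤ η * ‖S.toFun (Set.Ioc s t) w‖)
    (hbound : ∀ s t b, s ≤ t → t ≤ b →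
      ‖S.toFun (Set.Ioc s t) (v t - v b)‖ ≤ C * ‖S.toFun (Set.Ioc s t) w‖) :
    ∃ p : TimePartition, ∀ (q : TimePartition) i j, q.interval j ⊆ p.interval i →
      ‖stopIncr S q j (v (q.pt j.succ) - v (p.pt i.succ))‖ ≤ η * ‖stopIncr S q j w‖ ∨
      ‖stopIncr S q j (v (q.pt j.succ) - v (p.pt i.succ))‖ ≤
        C * ‖stopIncr S q j (S.toFun (Set.Ioi T) w)‖ := by
  obtain ⟨δ, hδ, hmesh⟩ := NNReal.nhds_zero_basis.eventually_iff.1 hmesh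
  obtain ⟨p, hTp, hp⟩ := TimePartition.exists_mesh_lt T hδ
  refine ⟨p, fun q i j hij => ?_⟩
  have hq := q.pt_castSucc_lt_pt_succ j
  obtain ⟨hright, hleft⟩ := (Set.Ioc_subset_Ioc_iff hq).1 hij
  rcases lt_or_ge (p.pt i.castSucc) T with hi | hi
  · left
    have hqT : q.pt j.succ ≤ T := hright.trans (p.pt_succ_le hTp hi)
    have hpδ : p.pt i.succ < q.pt j.succ + δ :=
      (hp i hi).trans_le (by gcongr; exact hleft.trans hq.le)
    rw [stopIncr]
    generalize q.pt j.castSucc = s, q.pt j.succ = t, p.pt i.succ = b at *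
    lift b to ℝ≥0 using ne_top_of_lt hpδ
    lift t to ℝ≥0 using ne_top_of_le_ne_top ENNReal.coe_ne_top hright
    lift s to ℝ≥0 using ne_top_of_lt hq
    norm_cast at hq hqT hright hpδ
    obtain ⟨r, rfl⟩ := exists_add_of_le hright
    rw [ENNReal.coe_add]
    exact hmesh (lt_of_add_lt_add_left hpδ) s t hq.le hqT
  · right
    rw [← mul_apply_eq_comp (stopIncr S q j), stopIncr_mul_apply_Ioi S (hi.trans hleft)]
    exact hbound _ _ _ hq.le hright

theorem exists_tendsto_riemannSum (h0 : S.toFun {0} = 0) (hT : S.toFun {∞} = 0) (hC : 0 ≤ C)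
    (hmesh : ∀ T : ℝ≥0, ∀ η > 0, ∀ᶠ r : ℝ≥0 in 𝓝 0, ∀ s t : ℝ≥0, s ≤ t → t ≤ T →
      ‖S.toFun (Set.Ioc s t) (v t - v (t + r))‖ ≤ η * ‖S.toFun (Set.Ioc s t) w‖)
    (hbound : ∀ s t b, s ≤ t → t ≤ b →
      ‖S.toFun (Set.Ioc s t) (v t - v b)‖ ≤ C * ‖S.toFun (Set.Ioc s t) w‖) :
    ∃ y, Tendsto (riemannSum S v) atTop (𝓝 y) := by
  refine exists_tendsto_of_eventually_norm_sub_le fun ε hε => ?_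
  have htail := ((S.tendsto_apply_Ioi_natCast hT w).norm.const_mul C)
  rw [norm_zero, mul_zero] at htail
  obtain ⟨n, hn⟩ := (htail.eventually_le_const (half_pos hε)).exists
  have hη : 0 < ε / 2 / (‖w‖ + 1) := by positivity
  have hη_le : ε / 2 / (‖w‖ + 1) * ‖w‖ ≤ ε / 2 := by
    rw [div_mul_eq_mul_div]
    exact div_le_of_le_mul₀ (by positivity) (by positivity) (by gcongr; linarith)
  obtain ⟨p, hp⟩ := exists_forall_norm_stopIncr_sub_le S n (hmesh n _ hη) hbound
  refine ⟨riemannSum S v p, (eventually_ge_atTop p).mono fun q hpq => ?_⟩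
  choose i hi using TimePartition.exists_interval_subset hpq
  rw [riemannSum_eq_sum_refinement S v hi, riemannSum, ← Finset.sum_sub_distrib]
  simp only [← map_sub]
  refine (norm_sum_stopIncr_apply_le S h0 q hη.le hC fun j => hp q (i j) j (hi j)).trans ?_
  exact (add_le_add hη_le hn).trans_eq (add_halves ε)

end RiemannSums

section StoppedFlow

variable {k : Type u} [NormedAddCommGroup k] [InnerProductSpace ℂ k] (S : QuantumStopTime k)

theorem flowSum_one (h0 : S.toFun {0} = 0) (p : TimePartition) : flowSum S p 1 = 1 := by
  simp only [flowSum, ccr_one, one_mul, sum_stopIncr S h0]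

theorem flowSum_mul (p : TimePartition) (X Y : F k →L[ℂ] F k) :
    flowSum S p (X * Y) = flowSum S p X * flowSum S p Y := by
  simp only [flowSum, ccr_mul]
  exact (sum_mul_mul_sum_mul_of_orthogonal
    (fun j => (isStarProjection_stopIncr S p j).isIdempotentElem)
    (fun _ _ => stopIncr_mul_stopIncr S p) _ fun j => commute_stopIncr_ccr S p j Y).symm

theorem flowSum_star (p : TimePartition) (X : F k →L[ℂ] F k) :
    flowSum S p (star X) = star (flowSum S p X) := by
  simp only [flowSum, ccr_star]
  exact (star_sum_mul_of_commute (fun j => (isStarProjection_stopIncr S p j).isSelfAdjoint)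
    fun j => commute_stopIncr_ccr S p j X).symm

theorem stopIncr_castSucc_mul_stopIncr_castSucc (p : TimePartition) {i j : Fin p.n} (hij : i ≠ j) :
    stopIncr S p i.castSucc * stopIncr S p j.castSucc = 0 :=
  stopIncr_mul_stopIncr S p ((Fin.castSucc_injective _).ne hij)

theorem commute_stopIncr_ccrFlowHom (p : TimePartition) (j : Fin p.n) (X : F k →L[ℂ] F k) :
    Commute (stopIncr S p j.castSucc) (ccrFlowHom (p.pt j.castSucc.succ).toNNReal X) := by
  rw [ccrFlowHom_apply, ← ccr_of_ne_top (p.pt_castSucc_succ_ne_top j)]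
  exact commute_stopIncr_ccr S p j.castSucc X

/-- The `*`-homomorphism `X ↦ σ_{S,π}(X) - S((π_n, ∞])`: the part of the Riemann sum over the
intervals with a finite right endpoint, on which `σ_t` is linear. -/
noncomputable def flowPart (p : TimePartition) :
    (F k →L[ℂ] F k) →⋆ₙₐ[ℂ] (F k →L[ℂ] F k) :=
  orthogonalSum (fun j : Fin p.n => (ccrFlowHom (p.pt j.castSucc.succ).toNNReal :
      (F k →L[ℂ] F k) →⋆ₐ[ℂ] (F k →L[ℂ] F k)).toNonUnitalStarAlgHom)
    (fun j => stopIncr S p j.castSucc) (fun j => isStarProjection_stopIncr S p j.castSucc)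
    (fun _ _ => stopIncr_castSucc_mul_stopIncr_castSucc S p) (commute_stopIncr_ccrFlowHom S p)

theorem flowPart_apply (p : TimePartition) (X : F k →L[ℂ] F k) :
    flowPart S p X = ∑ j : Fin p.n, ccr (p.pt j.castSucc.succ) X * stopIncr S p j.castSucc :=
  (orthogonalSum_apply _ _ _ _ _ X).trans <| Finset.sum_congr rfl fun j _ => by
    rw [ccr_of_ne_top (p.pt_castSucc_succ_ne_top j)]
    rfl

theorem flowSum_eq_flowPart_add (p : TimePartition) (X : F k →L[ℂ] F k) :
    flowSum S p X = flowPart S p X + stopIncr S p (Fin.last p.n) := by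
  rw [flowSum, Fin.sum_univ_castSucc, flowPart_apply, Fin.succ_last, p.pt_last, ccr_top, one_mul]

theorem flowSum_apply (p : TimePartition) (X : F k →L[ℂ] F k) (x : F k) :
    flowSum S p X x = riemannSum S (fun t => ccr t X x) p := by
  rw [flowSum, riemannSum, _root_.sum_apply]
  refine Finset.sum_congr rfl fun j _ => ?_
  rw [← (commute_stopIncr_ccr S p j X).eq, mul_apply_eq_comp]

theorem norm_Ioc_ccr_sub_ccr_ev_le {s t : ℝ≥0} (hst : s ≤ t) (r : ℝ≥0) (X : F k →L[ℂ] F k)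
    (f : L2 k) :
    ‖S.toFun (Set.Ioc s t) (ccr t X (ev f) - ccr (t + r) X (ev f))‖ ≤
      ‖(X - ccrFlow r X) (ev (leftShift k t f))‖ * ‖S.toFun (Set.Ioc s t) (ev f)‖ := by
  rw [← ENNReal.coe_add, ccr_coe, ccr_coe, ccrFlow_add, ← _root_.sub_apply, ← ccrFlowHom_apply t,
    ← ccrFlowHom_apply t (ccrFlow r X), ← map_sub, ccrFlowHom_apply]
  exact norm_apply_ccrFlow_ev_le (S.commute_Ioc_ccrFlow hst le_rfl) _ f

theorem norm_Ioc_ccr_sub_ccr_le {s t b : ℝ≥0∞} (hst : s ≤ t) (htb : t ≤ b) (X : F k →L[ℂ] F k)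
    (x : F k) :
    ‖S.toFun (Set.Ioc s t) (ccr t X x - ccr b X x)‖ ≤
      2 * (‖X‖ + 1) * ‖S.toFun (Set.Ioc s t) x‖ := by
  have hcomm : Commute (S.toFun (Set.Ioc s t)) (ccr t X - ccr b X) :=
    (S.commute_Ioc_ccr hst le_rfl X).sub_right (S.commute_Ioc_ccr hst htb X)
  have hnorm : ‖ccr t X - ccr b X‖ ≤ 2 * (‖X‖ + 1) :=
    (norm_sub_le_of_le (norm_ccr_le t X) (norm_ccr_le b X)).trans_eq (two_mul _).symm
  rw [← _root_.sub_apply, ← mul_apply_eq_comp, hcomm.eq, mul_apply_eq_comp]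
  exact (ccr t X - ccr b X).le_of_opNorm_le hnorm _

theorem exists_tendsto_flowSum_ev (h0 : S.toFun {0} = 0) (hT : S.toFun {∞} = 0)
    (X : F k →L[ℂ] F k) (f : L2 k) :
    ∃ y, Tendsto (fun p => flowSum S p X (ev f)) atTop (𝓝 y) := by
  simp only [flowSum_apply]
  refine exists_tendsto_riemannSum S h0 hT (w := ev f) (C := 2 * (‖X‖ + 1)) (by positivity)
    (fun T η hη => ?_) fun s t b hst htb => norm_Ioc_ccr_sub_ccr_le S hst htb X _
  filter_upwards [eventually_norm_sub_ccrFlow_ev_leftShift_le X f T hη] with r hr s t hst htT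
  exact (norm_Ioc_ccr_sub_ccr_ev_le S hst r X f).trans (by gcongr; exact hr t htT)

theorem tendsto_flowPart_iff (hT : S.toFun {∞} = 0) {X : F k →L[ℂ] F k} {x y : F k} :
    Tendsto (fun p => flowPart S p X x) atTop (𝓝 y) ↔
      Tendsto (fun p => flowSum S p X x) atTop (𝓝 y) := by
  have hlast := tendsto_stopIncr_last S hT x
  simp only [flowSum_eq_flowPart_add, _root_.add_apply]
  exact ⟨fun h => by simpa using h.add hlast, fun h => by simpa using h.sub hlast⟩

theorem exists_starAlgHom_tendsto_flowSum (h0 : S.toFun {0} = 0) (hT : S.toFun {∞} = 0) :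
    ∃ σ : (F k →L[ℂ] F k) →⋆ₐ[ℂ] (F k →L[ℂ] F k),
      ∀ X x, Tendsto (fun p => flowSum S p X x) atTop (𝓝 (σ X x)) := by
  simp only [← tendsto_flowPart_iff S hT]
  refine exists_starAlgHom_tendsto (flowPart S) (fun X => ?_) fun x => ?_
  · refine exists_continuousLinearMap_tendsto
      (fun p => NonUnitalStarAlgHom.norm_apply_le (flowPart S p) X) dense_span_ev ?_
    rintro _ ⟨f, rfl⟩
    simpa only [tendsto_flowPart_iff S hT] using exists_tendsto_flowSum_ev S h0 hT X f
  · rw [tendsto_flowPart_iff S hT]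
    simp only [flowSum_one S h0, one_apply_eq_self, tendsto_const_nhds]

end StoppedFlow

section StoppedShift

variable {k : Type u} [NormedAddCommGroup k] [InnerProductSpace ℂ k] (S : QuantumStopTime k)

theorem shiftSum_apply (p : TimePartition) (x : F k) :
    shiftSum S p x = riemannSum S (fun t => Gam k t x) p := by
  rw [shiftSum, riemannSum, _root_.sum_apply]
  rfl

theorem norm_Ioc_Gam {s t : ℝ≥0} (hst : s ≤ t) (x : F k) :
    ‖S.toFun (Set.Ioc s t) (Gam k t x)‖ = ‖S.toFun (Set.Ioc s t) (ev 0)‖ * ‖x‖ :=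
  norm_apply_Gam (S.commute_Ioc_ccrFlow hst le_rfl) x

theorem norm_Ioc_Gam_sub_Gam {s t : ℝ≥0} (hst : s ≤ t) (r : ℝ≥0∞) (x : F k) :
    ‖S.toFun (Set.Ioc s t) (Gam k t x - Gam k (t + r) x)‖ =
      ‖x - Gam k r x‖ * ‖S.toFun (Set.Ioc s t) (ev 0)‖ := by
  rw [Gam_coe_add, mul_apply_eq_comp, ← map_sub, norm_Ioc_Gam S hst, mul_comm]

theorem norm_Ioc_Gam_sub_Gam_le {s t b : ℝ≥0∞} (hst : s ≤ t) (htb : t ≤ b) (x : F k) :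
    ‖S.toFun (Set.Ioc s t) (Gam k t x - Gam k b x)‖ ≤
      2 * ‖x‖ * ‖S.toFun (Set.Ioc s t) (ev 0)‖ := by
  rcases eq_or_ne t ∞ with rfl | ht
  · rw [top_le_iff.1 htb, sub_self, map_zero, norm_zero]
    positivity
  · lift t to ℝ≥0 using ht
    lift s to ℝ≥0 using ne_top_of_le_ne_top ENNReal.coe_ne_top hst
    obtain ⟨r, rfl⟩ := exists_add_of_le htb
    rw [norm_Ioc_Gam_sub_Gam S (ENNReal.coe_le_coe.1 hst), two_mul]
    gcongr
    exact norm_sub_le_of_le le_rfl (norm_Gam_le r x)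

theorem exists_tendsto_shiftSum (h0 : S.toFun {0} = 0) (hT : S.toFun {∞} = 0) (x : F k) :
    ∃ y, Tendsto (fun p => shiftSum S p x) atTop (𝓝 y) := by
  simp only [shiftSum_apply]
  refine exists_tendsto_riemannSum S h0 hT (w := ev 0) (C := 2 * ‖x‖) (by positivity)
    (fun T η hη => ?_) fun s t b hst htb => norm_Ioc_Gam_sub_Gam_le S hst htb x
  have hcont := tendsto_iff_norm_sub_tendsto_zero.1 (tendsto_Gam_zero x)
  filter_upwards [hcont.eventually_le_const hη] with r hr s t hst _
  rw [norm_Ioc_Gam_sub_Gam S hst, norm_sub_rev]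
  gcongr

theorem norm_stopIncr_castSucc_Gam (p : TimePartition) (j : Fin p.n) (x : F k) :
    ‖stopIncr S p j.castSucc (Gam k (p.pt j.castSucc.succ) x)‖ =
      ‖stopIncr S p j.castSucc (ev 0)‖ * ‖x‖ := by
  have hlt := p.pt_castSucc_lt_pt_succ j.castSucc
  rw [stopIncr]
  lift p.pt j.castSucc.succ to ℝ≥0 using p.pt_castSucc_succ_ne_top j with t
  lift p.pt j.castSucc.castSucc to ℝ≥0 using p.pt_castSucc_ne_top _ with s
  exact norm_Ioc_Gam S (ENNReal.coe_lt_coe.1 hlt).le x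

theorem norm_sq_sum_stopIncr_castSucc (p : TimePartition) (y : Fin p.n → F k) :
    ‖∑ j : Fin p.n, stopIncr S p j.castSucc (y j)‖ ^ 2 =
      ∑ j : Fin p.n, ‖stopIncr S p j.castSucc (y j)‖ ^ 2 := by
  have hproj (j : Fin p.n) := isStarProjection_stopIncr S p j.castSucc
  have horth (i j : Fin p.n) (hij : i ≠ j) := stopIncr_castSucc_mul_stopIncr_castSucc S p hij
  exact norm_sq_sum_of_mul_eq_zero Finset.univ hproj horth y

theorem norm_shiftSum_sub (h0 : S.toFun {0} = 0) (p : TimePartition) (x : F k) :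
    ‖shiftSum S p x - stopIncr S p (Fin.last p.n) (vacProj k x)‖ =
      ‖ev 0 - stopIncr S p (Fin.last p.n) (ev 0)‖ * ‖x‖ := by
  have hsplit : shiftSum S p x - stopIncr S p (Fin.last p.n) (vacProj k x) =
      ∑ j : Fin p.n, stopIncr S p j.castSucc (Gam k (p.pt j.castSucc.succ) x) := by
    rw [shiftSum_apply, riemannSum, Fin.sum_univ_castSucc, Fin.succ_last, p.pt_last, Gam_top,
      add_sub_cancel_right]
  have hvac : ev 0 - stopIncr S p (Fin.last p.n) (ev 0) =
      ∑ j : Fin p.n, stopIncr S p j.castSucc (ev (0 : L2 k)) := by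
    rw [sub_eq_iff_eq_add, ← Fin.sum_univ_castSucc (fun j => stopIncr S p j (ev (0 : L2 k))),
      ← _root_.sum_apply, sum_stopIncr S h0, one_apply_eq_self]
  rw [← sq_eq_sq₀ (norm_nonneg _) (by positivity), mul_pow, hsplit, hvac,
    norm_sq_sum_stopIncr_castSucc, norm_sq_sum_stopIncr_castSucc, Finset.sum_mul]
  simp only [norm_stopIncr_castSucc_Gam, mul_pow]

theorem exists_linearIsometry_tendsto_shiftSum (h0 : S.toFun {0} = 0) (hT : S.toFun {∞} = 0) :
    ∃ Γ : F k →ₗᵢ[ℂ] F k, ∀ x, Tendsto (fun p => shiftSum S p x) atTop (𝓝 (Γ x)) := by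
  choose Γ hΓ using exists_tendsto_shiftSum S h0 hT
  have hnorm (x : F k) : ‖Γ x‖ = ‖x‖ := by
    have hleft := ((hΓ x).sub (tendsto_stopIncr_last S hT (vacProj k x))).norm
    have hright := ((tendsto_stopIncr_last S hT (ev 0)).const_sub (ev 0)).norm.mul_const ‖x‖
    simp only [norm_shiftSum_sub S h0, sub_zero] at hleft
    rw [sub_zero, norm_ev_zero, one_mul] at hright
    exact tendsto_nhds_unique hleft hright
  let Γ_lin : F k →ₗ[ℂ] F k :=
    linearMapOfTendsto Γ (fun p => (shiftSum S p).toLinearMap) (tendsto_pi_nhds.2 hΓ)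
  exact ⟨⟨Γ_lin, hnorm⟩, hΓ⟩

end StoppedShift

section Intertwining

variable {k : Type u} [NormedAddCommGroup k] [InnerProductSpace ℂ k] (S : QuantumStopTime k)

theorem flowPart_mul_stopIncr_last (p : TimePartition) (X : F k →L[ℂ] F k) :
    flowPart S p X * stopIncr S p (Fin.last p.n) = 0 := by
  rw [flowPart_apply, Finset.sum_mul]
  refine Finset.sum_eq_zero fun j _ => ?_
  rw [mul_assoc, stopIncr_mul_stopIncr S p (Fin.castSucc_lt_last j).ne, mul_zero]

theorem flowPart_mul_stopIncr_castSucc (p : TimePartition) (X : F k →L[ℂ] F k) (j : Fin p.n) :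
    flowPart S p X * stopIncr S p j.castSucc =
      stopIncr S p j.castSucc * ccr (p.pt j.castSucc.succ) X := by
  rw [flowPart_apply, Finset.sum_mul, Finset.sum_eq_single j, mul_assoc,
    (isStarProjection_stopIncr S p _).isIdempotentElem.eq, (commute_stopIncr_ccr S p _ X).eq]
  · intro i _ hij
    rw [mul_assoc, stopIncr_castSucc_mul_stopIncr_castSucc S p hij, mul_zero]
  · exact fun hj => (hj (Finset.mem_univ j)).elim

theorem flowPart_mul_shiftSum (p : TimePartition) (X : F k →L[ℂ] F k) :
    flowPart S p X * shiftSum S p =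
      shiftSum S p * X - stopIncr S p (Fin.last p.n) * vacProj k * X := by
  rw [shiftSum, Fin.sum_univ_castSucc, Fin.succ_last, p.pt_last, Gam_top, mul_add, add_mul,
    add_sub_cancel_right, ← mul_assoc, flowPart_mul_stopIncr_last, zero_mul, add_zero,
    Finset.mul_sum, Finset.sum_mul]
  refine Finset.sum_congr rfl fun j _ => ?_
  rw [← mul_assoc, flowPart_mul_stopIncr_castSucc, mul_assoc,
    ccr_mul_Gam (p.pt_castSucc_succ_ne_top j), mul_assoc]

theorem stoppedFlow_mul_stoppedShift (hT : S.toFun {∞} = 0) {X Y Γ : F k →L[ℂ] F k}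
    (hY : ∀ x, Tendsto (fun p => flowSum S p X x) atTop (𝓝 (Y x)))
    (hΓ : ∀ x, Tendsto (fun p => shiftSum S p x) atTop (𝓝 (Γ x))) : Y * Γ = Γ * X := by
  refine ContinuousLinearMap.ext fun x => ?_
  have hleft := tendsto_apply_of_norm_le
    (fun p => NonUnitalStarAlgHom.norm_apply_le (flowPart S p) X)
    ((tendsto_flowPart_iff S hT).2 (hY (Γ x))) (hΓ x)
  have hright := (hΓ (X x)).sub (tendsto_stopIncr_last S hT (vacProj k (X x)))
  rw [sub_zero] at hright
  refine tendsto_nhds_unique hleft (hright.congr fun p => ?_)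
  exact congrArg (fun T => T x) (flowPart_mul_shiftSum S p X).symm

end Intertwining

end QStop

theorem mainTheorem2_general {k : Type*} [NormedAddCommGroup k] [InnerProductSpace ℂ k]
    (S : QStop.QuantumStopTime k) (h0 : S.toFun {0} = 0) (hT : S.toFun {∞} = 0) :
    (∀ p : QStop.TimePartition,
      QStop.flowSum S p 1 = 1 ∧
      (∀ X Y, QStop.flowSum S p (X * Y) = QStop.flowSum S p X * QStop.flowSum S p Y) ∧
      (∀ X, QStop.flowSum S p (star X) = star (QStop.flowSum S p X)) ∧
      ∃ φ : (QStop.F k →L[ℂ] QStop.F k) →⋆ₙₐ[ℂ] (QStop.F k →L[ℂ] QStop.F k),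
        ∀ X, QStop.flowSum S p X = φ X + QStop.stopIncr S p (Fin.last p.n)) ∧
    ∃ σ : (QStop.F k →L[ℂ] QStop.F k) →⋆ₐ[ℂ] (QStop.F k →L[ℂ] QStop.F k),
      (∀ X x, Tendsto (fun p => QStop.flowSum S p X x) atTop (𝓝 (σ X x))) ∧
      ∃ Γ : QStop.F k →ₗᵢ[ℂ] QStop.F k,
        (∀ x, Tendsto (fun p => QStop.shiftSum S p x) atTop (𝓝 (Γ x))) ∧
        ∀ X, σ X * Γ.toContinuousLinearMap = Γ.toContinuousLinearMap * X := by
  refine ⟨fun p => ⟨QStop.flowSum_one S h0 p, QStop.flowSum_mul S p, QStop.flowSum_star S p,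
    QStop.flowPart S p, QStop.flowSum_eq_flowPart_add S p⟩, ?_⟩
  obtain ⟨σ, hσ⟩ := QStop.exists_starAlgHom_tendsto_flowSum S h0 hT
  obtain ⟨Γ, hΓ⟩ := QStop.exists_linearIsometry_tendsto_shiftSum S h0 hT
  exact ⟨σ, hσ, Γ, hΓ, fun X => QStop.stoppedFlow_mul_stoppedShift S hT (hσ X) hΓ⟩

theorem mainTheorem2 {k : Type*} [NormedAddCommGroup k] [InnerProductSpace ℂ k] [CompleteSpace k]
    (S : QStop.QuantumStopTime k) (hS : S.IsFinite) :
    (∀ p : QStop.TimePartition,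
      QStop.flowSum S p 1 = 1 ∧
      (∀ X Y, QStop.flowSum S p (X * Y) = QStop.flowSum S p X * QStop.flowSum S p Y) ∧
      (∀ X, QStop.flowSum S p (star X) = star (QStop.flowSum S p X)) ∧
      ∃ φ : (QStop.F k →L[ℂ] QStop.F k) →⋆ₙₐ[ℂ] (QStop.F k →L[ℂ] QStop.F k),
        ∀ X, QStop.flowSum S p X = φ X + QStop.stopIncr S p (Fin.last p.n)) ∧
    ∃ σ : (QStop.F k →L[ℂ] QStop.F k) →⋆ₐ[ℂ] (QStop.F k →L[ℂ] QStop.F k),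
      (∀ X x, Tendsto (fun p => QStop.flowSum S p X x) atTop (𝓝 (σ X x))) ∧
      ∃ Γ : QStop.F k →ₗᵢ[ℂ] QStop.F k,
        (∀ x, Tendsto (fun p => QStop.shiftSum S p x) atTop (𝓝 (Γ x))) ∧
        ∀ X, σ X * Γ.toContinuousLinearMap = Γ.toContinuousLinearMap * X :=
  mainTheorem2_general S hS.zero hS.top
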